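/- **Definitions.** A *BI algebra* is an algebra $(A,\wedge,\vee,\to,\top,\bot,*,-\!\!*,\top^*)$ such that $(A,\wedge,\vee,\to,\top,\bot)$ is a Heyting algebra, $(A,*,\top^*)$ is a commutative monoid and $a*b\le c \iff a\le b -\!\!* c$. A *DMBI algebra* is a BI algebra with a further constant $\bot^*$ such that, for ${\sim}a := a -\!\!* \bot^*$, one has ${\sim}{\sim}a=a$ and ${\sim}\top^*=\bot^*$. A *CBI algebra* is a DMBI algebra whose Heyting algebra reduct is a Boolean algebra. Homomorphisms preserve all these operations. A *DMBI frame* is $(X,\preccurlyeq,\circ,E,-)$ with $\preccurlyeq$ a preorder on $X$, $\circ:X^2\to\mathcal P(X)$, $E\subseteq X$ and $-:X\to X$ such that: (Commutativity) $z\in x\circ y\Rightarrow z\in y\circ x$; (Closure) $e\in E$ and $e\preccurlyeq e'$ imply $e'\in E$; (Unit Existence) for every $x$ there is $e\in E$ with $x\in x\circ e$; (Coherence) $e\in E$ and $x\in y\circ e$ imply $y\preccurlyeq x$; (Associativity) if $t\preccurlyeq t'$, $t\in x\circ y$ and $w\in t'\circ z$, then there are $s,s',w'$ with $s\preccurlyeq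 s'$, $s\in y\circ z$, $w'\preccurlyeq w$ and $w'\in x\circ s'$; (Dual) $y\preccurlyeq x\Rightarrow -x\preccurlyeq -y$; (Involutive) $--x=x$; (Compatibility) $z\in x\circ y\Rightarrow -x\in (-z)\circ y$. A *CBI frame* is a DMBI frame whose order is equality. The *complex algebra* $Com(X)$ of a DMBI frame consists of the upwards-closed subsets of $X$ with $\cap,\cup,X,\emptyset$, unit $E$, $\bot^*$ interpreted as $U=\{x\mid -x\notin E\}$, and $A\Rightarrow B=\{x\mid \forall x'\succcurlyeq x\,(x'\in A\Rightarrow x'\in B)\}$, $A\bullet B=\{x\mid \exists w,y,z\,(w\preccurlyeq x,\ w\in y\circ z,\ y\in A,\ z\in B)\}$, $A\mathbin{-\!\bullet} B=\{x\mid\forall w,y,z\,(x\preccurlyeq w,\ z\in w\circ y,\ y\in A\Rightarrow z\in B)\}$. The *prime filter frame* $Pr(\mathbb A)$ of a DMBI algebra $\mathbb A$ is the set of its prime filters ordered by $\subseteq$, with $F\circ F'=\{F''\mid \forall a\in F\,\forall b\in F':a*b\in F''\}$, $E=\{F\mid\top^*\in F\}$ and $-F$ the complement of ${\sim}F=\{{\sim}a\mid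 a\in F\}$. A *DMBI morphism* of DMBI frames is a map $g:X\to X'$ such that: $x\preccurlyeq y\Rightarrow g(x)\preccurlyeq g(y)$; $g(x)\preccurlyeq y'$ implies $g(y)=y'$ for some $y\succcurlyeq x$; $x\in y\circ z\Rightarrow g(x)\in g(y)\circ g(z)$; if $w'\preccurlyeq g(x)$ and $w'\in y'\circ z'$ there are $w\preccurlyeq x$ and $y,z$ with $w\in y\circ z$, $y'\preccurlyeq g(y)$, $z'\preccurlyeq g(z)$; if $g(x)\preccurlyeq w'$ and $z'\in w'\circ y'$ (respectively $z'\in y'\circ w'$) there are $w\succcurlyeq x$ and $y,z$ with $z\in w\circ y$ (respectively $z\in y\circ w$), $y'\preccurlyeq g(y)$, $g(z)\preccurlyeq z'$; $e\in E\iff g(e)\in E'$; and $g(-x)=-g(x)$. A *CBI morphism* of CBI frames is defined by the same conditions with $\preccurlyeq$ replaced by $=$. A *DMBI space* is a DMBI frame with a topology such that $(X,\preccurlyeq)$ is an Esakia space (compact, partially ordered, points $x\not\preccurlyeq y$ separated by a clopen up-set containing $x$ and not $y$, down-sets of clopen sets clopen), the upwards-closed clopen sets are closed under $\bullet$ and $-\!\bullet$,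 whenever $x\notin y\circ z$ there are upwards-closed clopen $C_1\ni y$, $C_2\ni z$ with $x\notin C_1\bullet C_2$, $E$ is clopen, and $-$ is continuous. A *CBI space* is a DMBI space whose order is equality. Morphisms of DMBI (CBI) spaces are continuous DMBI (CBI) morphisms. $Pr(\mathbb A)$ carries the topology with subbase all $\{F\mid a\in F\}$ and their complements. The logic DMBI has formulas $\varphi::=p\mid\top\mid\bot\mid\top^*\mid\varphi\wedge\varphi\mid\varphi\vee\varphi\mid\varphi\to\varphi\mid{\sim}\varphi\mid\varphi*\varphi\mid\varphi-\!\!*\varphi$, with $\bot^*:={\sim}\top^*$. Its Hilbert system has the rules $\varphi\vdash\varphi$; $\varphi\vdash\top$; $\bot\vdash\varphi$; from $\eta\vdash\varphi$ and $\eta\vdash\psi$ infer $\eta\vdash\varphi\wedge\psi$; from $\varphi\vdash\psi_1\wedge\psi_2$ infer $\varphi\vdash\psi_i$; from $\varphi\vdash\psi$ infer $\eta\wedge\varphi\vdash\psi$; from $\eta\vdash\psi$ and $\varphi\vdash\psi$ infer $\eta\vee\varphi\vdash\psi$; from $\varphi\vdash\psi_i$ infer $\varphi\vdash\psi_1\vee\psi_2$;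 from $\eta\vdash\varphi\to\psi$ and $\eta\vdash\varphi$ infer $\eta\vdash\psi$; from $\eta\wedge\varphi\vdash\psi$ infer $\eta\vdash\varphi\to\psi$; from $\xi\vdash\varphi$ and $\eta\vdash\psi$ infer $\xi*\eta\vdash\varphi*\psi$; from $\eta*\varphi\vdash\psi$ infer $\eta\vdash\varphi-\!\!*\psi$ and $\varphi\vdash\eta-\!\!*\psi$; from $\xi\vdash\varphi-\!\!*\psi$ and $\eta\vdash\varphi$ infer $\xi*\eta\vdash\psi$ and $\eta*\xi\vdash\psi$; $(\varphi*\psi)*\xi\vdash\varphi*(\psi*\xi)$; $\varphi*\psi\vdash\psi*\varphi$; $\varphi*\top^*\dashv\vdash\varphi$; ${\sim}{\sim}\varphi\dashv\vdash\varphi$; ${\sim}\varphi\dashv\vdash\varphi-\!\!*\bot^*$. CBI adds $\neg\neg\varphi\vdash\varphi$, where $\neg\varphi:=\varphi\to\bot$. Given a valuation $\mathcal V$ of the atoms by upwards-closed subsets of a DMBI frame, satisfaction at a point has the clauses: $x\vDash p$ iff $x\in\mathcal V(p)$; the usual intuitionistic Kripke clauses over $\preccurlyeq$ for $\top,\bot,\wedge,\vee,\to$;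 $x\vDash\top^*$ iff $x\in E$; $x\vDash{\sim}\varphi$ iff $-x\not\vDash\varphi$; $x\vDash\varphi*\psi$ iff there are $x'\preccurlyeq x$ and $y,z$ with $x'\in y\circ z$, $y\vDash\varphi$, $z\vDash\psi$; $x\vDash\varphi-\!\!*\psi$ iff for all $x'\succcurlyeq x$ and $z\in x'\circ y$, $y\vDash\varphi$ implies $z\vDash\psi$. Write $\varphi\vDash\psi$ if, for all DMBI (CBI) frames, all such valuations and all points $x$, $x\vDash\varphi$ implies $x\vDash\psi$. **Theorem.** 1. (Representation) For every DMBI (CBI) algebra $\mathbb A$, the prime filter frame $Pr(\mathbb A)$ is a DMBI (CBI) frame; in particular $-$ satisfies Dual, Involutive and Compatibility. The map $\theta_{\mathbb A}(a)=\{F\in Pr(\mathbb A)\mid a\in F\}$ is an embedding (an injective homomorphism) of $\mathbb A$ into $Com(Pr(\mathbb A))$, so $\mathbb A$ is isomorphic to a subalgebra of the complex algebra of its prime filter frame, which in the CBI case is a CBI algebra. 2. (Soundness and completeness) For all formulas $\varphi,\psi$, $\varphi\vdash\psi$ is provable in the Hilbert system of DMBI (CBI) iff $\varphi\vDash\psi$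 over DMBI (CBI) frames. 3. (Duality) $\mathbb A\mapsto Pr(\mathbb A)$, $f\mapsto f^{-1}$ is a contravariant functor from DMBI (CBI) algebras to DMBI (CBI) spaces. Together with the contravariant functor $Clop$ sending a space $X$ to the algebra of its upwards-closed clopen sets, with the operations of the complex algebra, and $g$ to $g^{-1}$, it forms a dual equivalence of categories: $\theta:\mathrm{Id}\to Clop\circ Pr$ and $\eta:\mathrm{Id}\to Pr\circ Clop$, $\eta_X(x)=\{C\in Clop(X)\mid x\in C\}$, are natural isomorphisms satisfying the triangle identities. -/

import Mathlib

open CategoryTheory Opposite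

universe u v w

/-! ## Algebras -/

/-- A BI algebra: a Heyting algebra with a commutative monoid structure `(*, 1)`, the unit `1` being
the multiplicative truth constant, such that `*` is residuated by the magic wand. -/
class BIAlgebra (A : Type u) extends HeytingAlgebra A, CommMonoid A where
  /-- The magic wand (multiplicative implication). -/
  wand : A → A → A
  mul_le_iff : ∀ a b c : A, a * b ≤ c ↔ a ≤ wand b c

/-- A DMBI algebra: a BI algebra with a constant `mbot` (multiplicative falsum) such that the
multiplicative negation `~a := wand a mbot` satisfies `~~a = a` and `~1 = mbot`. -/
class DMBIAlgebra (A : Type u) extends BIAlgebra A where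
  /-- Multiplicative falsum. -/
  mbot : A
  wand_wand_mbot : ∀ a : A, wand (wand a mbot) mbot = a
  wand_one_mbot : wand 1 mbot = mbot

/-- A CBI algebra: a DMBI algebra whose underlying Heyting algebra is a Boolean algebra
(here `aᶜ = a ⇨ ⊥`). -/
class IsCBIAlgebra (A : Type u) [DMBIAlgebra A] : Prop where
  sup_compl : ∀ a : A, a ⊔ aᶜ = ⊤

/-- The multiplicative negation `~a`. -/
def mneg {A : Type u} [DMBIAlgebra A] (a : A) : A := BIAlgebra.wand a DMBIAlgebra.mbot

/-- Homomorphisms of DMBI algebras (and of CBI algebras, which have the same signature). -/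
@[ext]
structure DMBIHom (A : Type u) (B : Type v) [DMBIAlgebra A] [DMBIAlgebra B] where
  toFun : A → B
  map_inf : ∀ a b, toFun (a ⊓ b) = toFun a ⊓ toFun b
  map_sup : ∀ a b, toFun (a ⊔ b) = toFun a ⊔ toFun b
  map_himp : ∀ a b, toFun (a ⇨ b) = toFun a ⇨ toFun b
  map_top : toFun ⊤ = ⊤
  map_bot : toFun ⊥ = ⊥
  map_mul : ∀ a b, toFun (a * b) = toFun a * toFun b
  map_wand : ∀ a b, toFun (BIAlgebra.wand a b) = BIAlgebra.wand (toFun a) (toFun b)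
  map_one : toFun 1 = 1
  map_mbot : toFun DMBIAlgebra.mbot = DMBIAlgebra.mbot

namespace DMBIHom

/-- The identity homomorphism. -/
def id (A : Type u) [DMBIAlgebra A] : DMBIHom A A where
  toFun a := a
  map_inf _ _ := rfl
  map_sup _ _ := rfl
  map_himp _ _ := rfl
  map_top := rfl
  map_bot := rfl
  map_mul _ _ := rfl
  map_wand _ _ := rfl
  map_one := rfl
  map_mbot := rfl

/-- Composition of homomorphisms, `f` first. -/
def comp {A : Type u} {B : Type v} {C : Type w} [DMBIAlgebra A] [DMBIAlgebra B] [DMBIAlgebra C]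
    (f : DMBIHom A B) (g : DMBIHom B C) : DMBIHom A C where
  toFun a := g.toFun (f.toFun a)
  map_inf a b := by rw [f.map_inf, g.map_inf]
  map_sup a b := by rw [f.map_sup, g.map_sup]
  map_himp a b := by rw [f.map_himp, g.map_himp]
  map_top := by rw [f.map_top, g.map_top]
  map_bot := by rw [f.map_bot, g.map_bot]
  map_mul a b := by rw [f.map_mul, g.map_mul]
  map_wand a b := by rw [f.map_wand, g.map_wand]
  map_one := by rw [f.map_one, g.map_one]
  map_mbot := by rw [f.map_mbot, g.map_mbot]

end DMBIHom

/-- A subset of a DMBI algebra closed under all the operations. -/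
structure IsDMBISubalgebra {B : Type u} [DMBIAlgebra B] (S : Set B) : Prop where
  inf_mem : ∀ a ∈ S, ∀ b ∈ S, a ⊓ b ∈ S
  sup_mem : ∀ a ∈ S, ∀ b ∈ S, a ⊔ b ∈ S
  himp_mem : ∀ a ∈ S, ∀ b ∈ S, a ⇨ b ∈ S
  top_mem : ⊤ ∈ S
  bot_mem : ⊥ ∈ S
  mul_mem : ∀ a ∈ S, ∀ b ∈ S, a * b ∈ S
  wand_mem : ∀ a ∈ S, ∀ b ∈ S, BIAlgebra.wand a b ∈ S
  one_mem : 1 ∈ S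
  mbot_mem : DMBIAlgebra.mbot ∈ S

/-! ## Frames -/

/-- The operations of a DMBI frame other than its order: a composition `X × X → 𝒫(X)`, a set of
units and a unary operation. -/
class FrameOps (X : Type u) where
  circ : X → X → Set X
  unit : Set X
  neg : X → X

open FrameOps in
/-- The conditions of a BI frame `(X, ≤, circ, unit)`, where `≤` is a preorder. -/
class IsBIFrame (X : Type u) [Preorder X] [FrameOps X] : Prop where
  commutativity : ∀ x y z : X, z ∈ circ x y → z ∈ circ y x
  closure : ∀ e e' : X, e ∈ unit → e ≤ e' → e' ∈ unit
  unit_existence : ∀ x : X, ∃ e ∈ (unit : Set X), x ∈ circ x e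
  coherence : ∀ x y e : X, e ∈ unit → x ∈ circ y e → y ≤ x
  associativity : ∀ x y z t t' w : X, t ≤ t' → t ∈ circ x y → w ∈ circ t' z →
    ∃ s s' w' : X, s ≤ s' ∧ s ∈ circ y z ∧ w' ≤ w ∧ w' ∈ circ x s'

open FrameOps in
/-- The conditions of a DMBI frame `(X, ≤, circ, unit, neg)`. -/
class IsDMBIFrame (X : Type u) [Preorder X] [FrameOps X] : Prop extends IsBIFrame X where
  dual : ∀ x y : X, y ≤ x → neg x ≤ neg y
  involutive : ∀ x : X, neg (neg x) = x
  compatibility : ∀ x y z : X, z ∈ circ x y → neg x ∈ circ (neg z) y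

/-- A CBI frame: a DMBI frame whose order is equality. -/
class IsCBIFrame (X : Type u) [Preorder X] [FrameOps X] : Prop extends IsDMBIFrame X where
  eq_of_le : ∀ x y : X, x ≤ y → x = y

open FrameOps in
/-- DMBI morphisms of frames. -/
structure IsDMBIMorphism {X : Type u} {Y : Type v} [Preorder X] [FrameOps X] [Preorder Y]
    [FrameOps Y] (g : X → Y) : Prop where
  mono : ∀ x y, x ≤ y → g x ≤ g y
  lift_le : ∀ x y', g x ≤ y' → ∃ y, x ≤ y ∧ g y = y'
  map_circ : ∀ x y z, x ∈ circ y z → g x ∈ circ (g y) (g z)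
  lift_circ : ∀ x w' y' z', w' ≤ g x → w' ∈ circ y' z' →
    ∃ w y z, w ≤ x ∧ w ∈ circ y z ∧ y' ≤ g y ∧ z' ≤ g z
  lift_left : ∀ x w' y' z', g x ≤ w' → z' ∈ circ w' y' →
    ∃ w y z, x ≤ w ∧ z ∈ circ w y ∧ y' ≤ g y ∧ g z ≤ z'
  lift_right : ∀ x w' y' z', g x ≤ w' → z' ∈ circ y' w' →
    ∃ w y z, x ≤ w ∧ z ∈ circ y w ∧ y' ≤ g y ∧ g z ≤ z'
  unit_iff : ∀ e, e ∈ (unit : Set X) ↔ g e ∈ (unit : Set Y)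
  map_neg : ∀ x, g (neg x) = neg (g x)

open FrameOps in
/-- CBI morphisms of frames. -/
structure IsCBIMorphism {X : Type u} {Y : Type v} [FrameOps X] [FrameOps Y] (g : X → Y) :
    Prop where
  map_circ : ∀ x y z, x ∈ circ y z → g x ∈ circ (g y) (g z)
  lift_circ : ∀ x y' z', g x ∈ circ y' z' → ∃ y z, x ∈ circ y z ∧ g y = y' ∧ g z = z'
  lift_left : ∀ x y' z', z' ∈ circ (g x) y' → ∃ y z, z ∈ circ x y ∧ g y = y' ∧ g z = z'
  lift_right : ∀ x y' z', z' ∈ circ y' (g x) → ∃ y z, z ∈ circ y x ∧ g y = y' ∧ g z = z'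
  unit_iff : ∀ e, e ∈ (unit : Set X) ↔ g e ∈ (unit : Set Y)
  map_neg : ∀ x, g (neg x) = neg (g x)

/-- Over frames whose order is equality, CBI morphisms are the same as DMBI morphisms. -/
theorem isCBIMorphism_iff {X : Type u} {Y : Type v} [Preorder X] [FrameOps X] [Preorder Y]
    [FrameOps Y] (hX : ∀ x y : X, x ≤ y → x = y) (hY : ∀ x y : Y, x ≤ y → x = y) (g : X → Y) :
    IsCBIMorphism g ↔ IsDMBIMorphism g := by
  constructor
  · intro h
    refine ⟨?_, ?_, h.map_circ, ?_, ?_, ?_, h.unit_iff, h.map_neg⟩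
    · intro x y hxy
      rw [hX x y hxy]
    · intro x y' hxy
      exact ⟨x, le_rfl, hY _ _ hxy⟩
    · intro x w' y' z' hw hc
      obtain rfl := hY _ _ hw
      obtain ⟨y, z, h1, h2, h3⟩ := h.lift_circ x y' z' hc
      exact ⟨x, y, z, le_rfl, h1, h2.ge, h3.ge⟩
    · intro x w' y' z' hw hc
      obtain rfl := hY _ _ hw
      obtain ⟨y, z, h1, h2, h3⟩ := h.lift_left x y' z' hc
      exact ⟨x, y, z, le_rfl, h1, h2.ge, h3.le⟩
    · intro x w' y' z' hw hc
      obtain rfl := hY _ _ hw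
      obtain ⟨y, z, h1, h2, h3⟩ := h.lift_right x y' z' hc
      exact ⟨x, y, z, le_rfl, h1, h2.ge, h3.le⟩
  · intro h
    refine ⟨h.map_circ, ?_, ?_, ?_, h.unit_iff, h.map_neg⟩
    · intro x y' z' hc
      obtain ⟨w, y, z, h1, h2, h3, h4⟩ := h.lift_circ x (g x) y' z' le_rfl hc
      obtain rfl := hX _ _ h1
      exact ⟨y, z, h2, (hY _ _ h3).symm, (hY _ _ h4).symm⟩
    · intro x y' z' hc
      obtain ⟨w, y, z, h1, h2, h3, h4⟩ := h.lift_left x (g x) y' z' le_rfl hc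
      obtain rfl := hX _ _ h1
      exact ⟨y, z, h2, (hY _ _ h3).symm, hY _ _ h4⟩
    · intro x y' z' hc
      obtain ⟨w, y, z, h1, h2, h3, h4⟩ := h.lift_right x (g x) y' z' le_rfl hc
      obtain rfl := hX _ _ h1
      exact ⟨y, z, h2, (hY _ _ h3).symm, hY _ _ h4⟩

/-! ## Complex algebras -/

namespace Complex

variable {X : Type u} [Preorder X] [FrameOps X]

/-- `A ⇒ B` on sets. -/
def imp (A B : Set X) : Set X := {x | ∀ x', x ≤ x' → x' ∈ A → x' ∈ B}

/-- `A • B` on sets. -/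
def star (A B : Set X) : Set X := {x | ∃ w y z, w ≤ x ∧ w ∈ FrameOps.circ y z ∧ y ∈ A ∧ z ∈ B}

/-- The residual of `•` on sets. -/
def wand (A B : Set X) : Set X :=
  {x | ∀ w y z, x ≤ w → z ∈ FrameOps.circ w y → y ∈ A → z ∈ B}

variable (X) in
/-- The set `U` interpreting multiplicative falsum. -/
def falsum : Set X := {x | FrameOps.neg x ∉ (FrameOps.unit : Set X)}

theorem isUpperSet_imp (A B : Set X) : IsUpperSet (imp A B) :=
  fun _ _ hab ha x' hx' => ha x' (hab.trans hx')

theorem isUpperSet_star (A B : Set X) : IsUpperSet (star A B) := by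
  rintro a b hab ⟨w, y, z, h1, h2⟩
  exact ⟨w, y, z, h1.trans hab, h2⟩

theorem isUpperSet_wand (A B : Set X) : IsUpperSet (wand A B) :=
  fun _ _ hab ha w y z hw => ha w y z (hab.trans hw)

theorem isUpperSet_unit [IsBIFrame X] : IsUpperSet (FrameOps.unit : Set X) :=
  fun a b hab ha => IsBIFrame.closure a b ha hab

theorem isUpperSet_falsum [IsDMBIFrame X] : IsUpperSet (falsum X) :=
  fun a b hab ha hb => ha (IsBIFrame.closure _ _ hb (IsDMBIFrame.dual _ _ hab))

/-- If the order is equality then every set is upwards closed. -/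
theorem isUpperSet_of_discrete (hX : ∀ x y : X, x ≤ y → x = y) (A : Set X) : IsUpperSet A :=
  fun a b hab ha => hX a b hab ▸ ha

/-- If the order is equality then `A ⇒ B` is the Boolean implication. -/
theorem imp_of_discrete (hX : ∀ x y : X, x ≤ y → x = y) (A B : Set X) : imp A B = Aᶜ ∪ B := by
  ext x
  constructor
  · intro h
    by_cases hx : x ∈ A
    · exact Or.inr (h x le_rfl hx)
    · exact Or.inl hx
  · rintro h x' hx' hA
    obtain rfl := hX _ _ hx'
    exact h.resolve_left (fun h' => h' hA)

theorem star_comm [IsBIFrame X] (A B : Set X) : star A B = star B A := by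
  have key : ∀ A B : Set X, star A B ⊆ star B A := by
    rintro A B x ⟨w, y, z, h1, h2, h3, h4⟩
    exact ⟨w, z, y, h1, IsBIFrame.commutativity _ _ _ h2, h4, h3⟩
  exact Set.Subset.antisymm (key A B) (key B A)

theorem star_subset_iff {A B C : Set X} (hA : IsUpperSet A) (hC : IsUpperSet C) :
    star A B ⊆ C ↔ A ⊆ wand B C := by
  constructor
  · intro h x hx w y z hw hz hy
    exact h ⟨z, w, y, le_rfl, hz, hA hw hx, hy⟩
  · rintro h x ⟨w, y, z, h1, h2, h3, h4⟩
    exact hC h1 (h h3 y z w le_rfl h2 h4)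

theorem star_assoc [IsBIFrame X] (A B C : Set X) : star (star A B) C = star A (star B C) := by
  have key : ∀ A B C : Set X, star (star A B) C ⊆ star A (star B C) := by
    rintro A B C v ⟨w, t', z, hw, hwc, ⟨t, x, y, ht, htc, hx, hy⟩, hz⟩
    obtain ⟨s, s', w', h1, h2, h3, h4⟩ := IsBIFrame.associativity x y z t t' w ht htc hwc
    exact ⟨w', x, s', h3.trans hw, h4, hx, s, y, z, h1, h2, hy, hz⟩
  refine Set.Subset.antisymm (key A B C) ?_
  rw [star_comm A, star_comm B, star_comm _ C, star_comm A]
  exact key C B A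

theorem star_unit [IsBIFrame X] {A : Set X} (hA : IsUpperSet A) :
    star A (FrameOps.unit : Set X) = A := by
  ext x
  constructor
  · rintro ⟨w, y, e, h1, h2, h3, h4⟩
    exact hA ((IsBIFrame.coherence _ _ _ h4 h2).trans h1) h3
  · intro hx
    obtain ⟨e, he, hc⟩ := IsBIFrame.unit_existence x
    exact ⟨x, x, e, le_rfl, hc, hx, he⟩

theorem wand_falsum [IsDMBIFrame X] {A : Set X} (hA : IsUpperSet A) :
    wand A (falsum X) = {x | FrameOps.neg x ∉ A} := by
  ext x
  constructor
  · intro hx hn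
    obtain ⟨e, he, hc⟩ := IsBIFrame.unit_existence x
    have h1 := IsDMBIFrame.compatibility _ _ _ (IsBIFrame.commutativity _ _ _ hc)
    have h2 := hx x _ _ le_rfl (IsBIFrame.commutativity _ _ _ h1) hn
    apply h2
    rwa [IsDMBIFrame.involutive]
  · intro hx w y z hw hz hy hE
    have h1 := IsDMBIFrame.compatibility _ _ _ hz
    have h2 := IsBIFrame.coherence _ _ _ hE (IsBIFrame.commutativity _ _ _ h1)
    exact hx (hA (h2.trans (IsDMBIFrame.dual _ _ hw)) hy)

/-- The DMBI algebra formed by a family `p` of upwards closed subsets of a DMBI frame that is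
closed under the operations of the complex algebra. -/
@[reducible]
def algebraOfSets [IsDMBIFrame X] (p : Set X → Prop) (hp : ∀ A, p A → IsUpperSet A)
    (hinter : ∀ A B, p A → p B → p (A ∩ B)) (hunion : ∀ A B, p A → p B → p (A ∪ B))
    (himp : ∀ A B, p A → p B → p (imp A B)) (huniv : p Set.univ) (hempty : p ∅)
    (hstar : ∀ A B, p A → p B → p (star A B)) (hwand : ∀ A B, p A → p B → p (wand A B))
    (hunit : p FrameOps.unit) (hfalsum : p (falsum X)) : DMBIAlgebra {A : Set X // p A} where
  le A B := A.1 ⊆ B.1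
  le_refl A := Set.Subset.refl A.1
  le_trans _ _ _ h h' := Set.Subset.trans h h'
  le_antisymm _ _ h h' := Subtype.ext (Set.Subset.antisymm h h')
  inf A B := ⟨A.1 ∩ B.1, hinter _ _ A.2 B.2⟩
  inf_le_left _ _ := Set.inter_subset_left
  inf_le_right _ _ := Set.inter_subset_right
  le_inf _ _ _ h h' := Set.subset_inter h h'
  sup A B := ⟨A.1 ∪ B.1, hunion _ _ A.2 B.2⟩
  le_sup_left _ _ := Set.subset_union_left
  le_sup_right _ _ := Set.subset_union_right
  sup_le _ _ _ h h' := Set.union_subset h h'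
  top := ⟨Set.univ, huniv⟩
  le_top A := Set.subset_univ A.1
  bot := ⟨∅, hempty⟩
  bot_le A := Set.empty_subset A.1
  himp A B := ⟨imp A.1 B.1, himp _ _ A.2 B.2⟩
  le_himp_iff A B C := by
    constructor
    · rintro h x ⟨hx, hx'⟩
      exact h hx x le_rfl hx'
    · intro h x hx x' hxx' hx'
      exact h ⟨hp _ A.2 hxx' hx, hx'⟩
  compl A := ⟨imp A.1 ∅, himp _ _ A.2 hempty⟩
  himp_bot _ := rfl
  mul A B := ⟨star A.1 B.1, hstar _ _ A.2 B.2⟩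
  mul_assoc A B C := Subtype.ext (star_assoc A.1 B.1 C.1)
  mul_comm A B := Subtype.ext (star_comm A.1 B.1)
  one := ⟨FrameOps.unit, hunit⟩
  mul_one A := Subtype.ext (star_unit (hp _ A.2))
  one_mul A := Subtype.ext ((star_comm _ _).trans (star_unit (hp _ A.2)))
  wand A B := ⟨wand A.1 B.1, hwand _ _ A.2 B.2⟩
  mul_le_iff A B C := star_subset_iff (hp _ A.2) (hp _ C.2)
  mbot := ⟨falsum X, hfalsum⟩
  wand_wand_mbot A := by
    apply Subtype.ext
    change wand (wand A.1 (falsum X)) (falsum X) = A.1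
    rw [wand_falsum (isUpperSet_wand _ _), wand_falsum (hp _ A.2)]
    ext x
    simp [IsDMBIFrame.involutive]
  wand_one_mbot := Subtype.ext (wand_falsum isUpperSet_unit)

end Complex

/-- The carrier of the complex algebra of a frame: the upwards closed sets. -/
def Com (X : Type u) [Preorder X] : Type u := {A : Set X // IsUpperSet A}

/-- The complex algebra of a DMBI frame. -/
instance Com.instDMBIAlgebra (X : Type u) [Preorder X] [FrameOps X] [IsDMBIFrame X] :
    DMBIAlgebra (Com X) :=
  Complex.algebraOfSets IsUpperSet (fun _ h => h) (fun _ _ => IsUpperSet.inter)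
    (fun _ _ => IsUpperSet.union) (fun _ _ _ _ => Complex.isUpperSet_imp _ _) isUpperSet_univ
    isUpperSet_empty (fun _ _ _ _ => Complex.isUpperSet_star _ _)
    (fun _ _ _ _ => Complex.isUpperSet_wand _ _) Complex.isUpperSet_unit Complex.isUpperSet_falsum

/-- The complex algebra of a CBI frame is a CBI algebra. Its carrier is the whole powerset and its
implication is Boolean, by `Complex.isUpperSet_of_discrete` and `Complex.imp_of_discrete`. -/
instance Com.instIsCBIAlgebra (X : Type u) [Preorder X] [FrameOps X] [IsCBIFrame X] :
    IsCBIAlgebra (Com X) where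
  sup_compl A := by
    apply Subtype.ext
    change A.1 ∪ Complex.imp A.1 ∅ = Set.univ
    rw [Complex.imp_of_discrete IsCBIFrame.eq_of_le]
    simp

/-! ## Prime filters -/

/-- Prime filters of (the bounded distributive lattice reduct of) an algebra. -/
@[ext]
structure PrimeFilter (A : Type u) [DMBIAlgebra A] where
  carrier : Set A
  nonempty : carrier.Nonempty
  mem_of_le : ∀ a b, a ∈ carrier → a ≤ b → b ∈ carrier
  inf_mem : ∀ a b, a ∈ carrier → b ∈ carrier → a ⊓ b ∈ carrier
  bot_notMem : ⊥ ∉ carrier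
  prime : ∀ a b, a ⊔ b ∈ carrier → a ∈ carrier ∨ b ∈ carrier

section mneg

variable {A : Type u} [DMBIAlgebra A]

theorem mneg_mneg (a : A) : mneg (mneg a) = a := DMBIAlgebra.wand_wand_mbot a

theorem le_mneg_comm {a b : A} : a ≤ mneg b ↔ b ≤ mneg a := by
  unfold mneg
  rw [← BIAlgebra.mul_le_iff, ← BIAlgebra.mul_le_iff, mul_comm]

theorem mneg_le_mneg {a b : A} (h : a ≤ b) : mneg b ≤ mneg a := by
  rw [le_mneg_comm, mneg_mneg]
  exact h

theorem mneg_inf (a b : A) : mneg (a ⊓ b) = mneg a ⊔ mneg b := by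
  apply le_antisymm
  · rw [← mneg_mneg (mneg a ⊔ mneg b)]
    apply mneg_le_mneg
    apply le_inf
    · exact (mneg_le_mneg le_sup_left).trans (mneg_mneg a).le
    · exact (mneg_le_mneg le_sup_right).trans (mneg_mneg b).le
  · exact sup_le (mneg_le_mneg inf_le_left) (mneg_le_mneg inf_le_right)

theorem mem_image_mneg {S : Set A} {a : A} : a ∈ mneg '' S ↔ mneg a ∈ S := by
  constructor
  · rintro ⟨b, hb, rfl⟩
    rwa [mneg_mneg]
  · intro h
    exact ⟨_, h, mneg_mneg a⟩

end mneg

namespace PrimeFilter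

variable {A : Type u} {B : Type v} [DMBIAlgebra A] [DMBIAlgebra B]

/-- Prime filters are ordered by inclusion. -/
instance : PartialOrder (PrimeFilter A) where
  le F G := F.carrier ⊆ G.carrier
  le_refl F := Set.Subset.refl F.carrier
  le_trans _ _ _ h h' := Set.Subset.trans h h'
  le_antisymm _ _ h h' := PrimeFilter.ext (Set.Subset.antisymm h h')

/-- `-F`, the complement of `~F = {~a | a ∈ F}`. -/
def neg (F : PrimeFilter A) : PrimeFilter A where
  carrier := (mneg '' F.carrier)ᶜ
  nonempty := by
    refine ⟨⊤, fun h => F.bot_notMem ?_⟩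
    refine F.mem_of_le _ _ (mem_image_mneg.1 h) ?_
    rw [← mneg_mneg (⊥ : A)]
    exact mneg_le_mneg le_top
  mem_of_le a b ha hab hb :=
    ha (mem_image_mneg.2 (F.mem_of_le _ _ (mem_image_mneg.1 hb) (mneg_le_mneg hab)))
  inf_mem a b ha hb hab := by
    rw [mem_image_mneg, mneg_inf] at hab
    rcases F.prime _ _ hab with h | h
    · exact ha (mem_image_mneg.2 h)
    · exact hb (mem_image_mneg.2 h)
  bot_notMem h := by
    obtain ⟨x, hx⟩ := F.nonempty
    exact h (mem_image_mneg.2 (F.mem_of_le _ _ hx (le_mneg_comm.1 bot_le)))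
  prime a b hab := by
    by_contra hcon
    simp only [Set.mem_compl_iff, mem_image_mneg] at hab hcon
    push Not at hcon
    refine hab (F.mem_of_le _ _ (F.inf_mem _ _ hcon.1 hcon.2) ?_)
    exact le_mneg_comm.1 (sup_le (le_mneg_comm.1 inf_le_left) (le_mneg_comm.1 inf_le_right))

/-- The operations of the prime filter frame. -/
instance : FrameOps (PrimeFilter A) where
  circ F G := {H | ∀ a ∈ F.carrier, ∀ b ∈ G.carrier, a * b ∈ H.carrier}
  unit := {F | 1 ∈ F.carrier}
  neg := neg

/-- The topology of the prime filter space, generated by the sets `{F | a ∈ F}` and their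
complements. -/
instance : TopologicalSpace (PrimeFilter A) :=
  TopologicalSpace.generateFrom
    {S | ∃ a : A, S = {F | a ∈ F.carrier} ∨ S = {F | a ∈ F.carrier}ᶜ}

/-- The inverse image of a prime filter under a homomorphism. -/
def comap (f : DMBIHom A B) (F : PrimeFilter B) : PrimeFilter A where
  carrier := f.toFun ⁻¹' F.carrier
  nonempty := by
    obtain ⟨x, hx⟩ := F.nonempty
    refine ⟨⊤, ?_⟩
    rw [Set.mem_preimage, f.map_top]
    exact F.mem_of_le _ _ hx le_top
  mem_of_le a b ha hab := by
    refine F.mem_of_le _ _ ha ?_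
    rw [← inf_eq_left, ← f.map_inf, inf_eq_left.2 hab]
  inf_mem a b ha hb := by
    rw [Set.mem_preimage, f.map_inf]
    exact F.inf_mem _ _ ha hb
  bot_notMem := by
    rw [Set.mem_preimage, f.map_bot]
    exact F.bot_notMem
  prime a b hab := by
    rw [Set.mem_preimage, f.map_sup] at hab
    exact F.prime _ _ hab

end PrimeFilter

/-- The map `a ↦ {F | a ∈ F}` from an algebra to the complex algebra of its prime filter frame. -/
def theta (A : Type u) [DMBIAlgebra A] (a : A) : Com (PrimeFilter A) :=
  ⟨{F | a ∈ F.carrier}, fun _ _ hFG hF => hFG hF⟩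

/-! ## Spaces -/

/-- Esakia spaces: compact Priestley spaces in which the down-set generated by a clopen set is
clopen. -/
class IsEsakiaSpace (X : Type u) [TopologicalSpace X] [PartialOrder X] : Prop extends
    CompactSpace X, PriestleySpace X where
  isClopen_lowerClosure : ∀ C : Set X, IsClopen C → IsClopen (lowerClosure C : Set X)

/-- DMBI spaces. As `circ` is commutative, closure under the left residual of `•` also gives closure
under its right residual. -/
class IsDMBISpace (X : Type u) [TopologicalSpace X] [PartialOrder X] [FrameOps X] : Prop extends
    IsEsakiaSpace X, IsDMBIFrame X where
  isClopen_star : ∀ C D : Set X, IsClopen C → IsUpperSet C → IsClopen D → IsUpperSet D →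
    IsClopen (Complex.star C D)
  isClopen_wand : ∀ C D : Set X, IsClopen C → IsUpperSet C → IsClopen D → IsUpperSet D →
    IsClopen (Complex.wand C D)
  exists_of_notMem_circ : ∀ x y z : X, x ∉ FrameOps.circ y z →
    ∃ C D : Set X, IsClopen C ∧ IsUpperSet C ∧ IsClopen D ∧ IsUpperSet D ∧
      y ∈ C ∧ z ∈ D ∧ x ∉ Complex.star C D
  isClopen_unit : IsClopen (FrameOps.unit : Set X)
  continuous_neg : Continuous (FrameOps.neg : X → X)

/-- The carrier of the algebra of a space: the upwards closed clopen sets. -/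
def Clop (X : Type u) [TopologicalSpace X] [Preorder X] : Type u :=
  {A : Set X // IsClopen A ∧ IsUpperSet A}

theorem isClopen_imp {X : Type u} [TopologicalSpace X] [PartialOrder X] [IsEsakiaSpace X]
    {A B : Set X} (hA : IsClopen A) (hB : IsClopen B) : IsClopen (Complex.imp A B) := by
  have h : Complex.imp A B = (lowerClosure (A \ B) : Set X)ᶜ := by
    ext x
    simp only [Complex.imp, Set.mem_ofPred_eq, Set.mem_compl_iff, SetLike.mem_coe,
      mem_lowerClosure, Set.mem_sdiff, not_exists, not_and]
    constructor
    · intro h y hy hxy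
      exact hy.2 (h y hxy hy.1)
    · intro h y hxy hyA
      by_contra hyB
      exact h y ⟨hyA, hyB⟩ hxy
  rw [h]
  exact (IsEsakiaSpace.isClopen_lowerClosure _ (hA.diff hB)).compl

/-- The algebra of upwards closed clopen sets of a DMBI space, with the operations of the complex
algebra. -/
instance Clop.instDMBIAlgebra (X : Type u) [TopologicalSpace X] [PartialOrder X] [FrameOps X]
    [IsDMBISpace X] : DMBIAlgebra (Clop X) :=
  Complex.algebraOfSets (fun A => IsClopen A ∧ IsUpperSet A) (fun _ h => h.2)
    (fun _ _ h h' => ⟨h.1.inter h'.1, h.2.inter h'.2⟩)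
    (fun _ _ h h' => ⟨h.1.union h'.1, h.2.union h'.2⟩)
    (fun _ _ h h' => ⟨isClopen_imp h.1 h'.1, Complex.isUpperSet_imp _ _⟩)
    ⟨isClopen_univ, isUpperSet_univ⟩ ⟨isClopen_empty, isUpperSet_empty⟩
    (fun _ _ h h' => ⟨IsDMBISpace.isClopen_star _ _ h.1 h.2 h'.1 h'.2,
      Complex.isUpperSet_star _ _⟩)
    (fun _ _ h h' => ⟨IsDMBISpace.isClopen_wand _ _ h.1 h.2 h'.1 h'.2,
      Complex.isUpperSet_wand _ _⟩)
    ⟨IsDMBISpace.isClopen_unit, Complex.isUpperSet_unit⟩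
    ⟨IsDMBISpace.isClopen_unit.compl.preimage IsDMBISpace.continuous_neg,
      Complex.isUpperSet_falsum⟩

theorem Clop.isCBIAlgebra (X : Type u) [TopologicalSpace X] [PartialOrder X] [FrameOps X]
    [IsDMBISpace X] (hX : ∀ x y : X, x ≤ y → x = y) : IsCBIAlgebra (Clop X) where
  sup_compl A := by
    apply Subtype.ext
    change A.1 ∪ Complex.imp A.1 ∅ = Set.univ
    rw [Complex.imp_of_discrete hX]
    simp

/-- The inverse image homomorphism of a continuous DMBI morphism. -/
def Clop.comap {X : Type u} {Y : Type v} [TopologicalSpace X] [PartialOrder X] [FrameOps X]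
    [IsDMBISpace X] [TopologicalSpace Y] [PartialOrder Y] [FrameOps Y] [IsDMBISpace Y]
    (g : X → Y) (hg : Continuous g) (hm : IsDMBIMorphism g) : DMBIHom (Clop Y) (Clop X) where
  toFun C := ⟨g ⁻¹' C.1, C.2.1.preimage hg, fun _ _ hab ha => C.2.2 (hm.mono _ _ hab) ha⟩
  map_inf _ _ := rfl
  map_sup _ _ := rfl
  map_himp C D := by
    apply Subtype.ext
    change g ⁻¹' Complex.imp C.1 D.1 = Complex.imp (g ⁻¹' C.1) (g ⁻¹' D.1)
    ext x
    constructor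
    · intro h x' hx hC
      exact h _ (hm.mono _ _ hx) hC
    · intro h y' hy hC
      obtain ⟨y, hxy, rfl⟩ := hm.lift_le _ _ hy
      exact h y hxy hC
  map_top := rfl
  map_bot := rfl
  map_mul C D := by
    apply Subtype.ext
    change g ⁻¹' Complex.star C.1 D.1 = Complex.star (g ⁻¹' C.1) (g ⁻¹' D.1)
    ext x
    constructor
    · rintro ⟨w', y', z', hw, hc, hC, hD⟩
      obtain ⟨w, y, z, h1, h2, h3, h4⟩ := hm.lift_circ _ _ _ _ hw hc
      exact ⟨w, y, z, h1, h2, C.2.2 h3 hC, D.2.2 h4 hD⟩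
    · rintro ⟨w, y, z, hw, hc, hC, hD⟩
      exact ⟨g w, g y, g z, hm.mono _ _ hw, hm.map_circ _ _ _ hc, hC, hD⟩
  map_wand C D := by
    apply Subtype.ext
    change g ⁻¹' Complex.wand C.1 D.1 = Complex.wand (g ⁻¹' C.1) (g ⁻¹' D.1)
    ext x
    constructor
    · intro h w y z hw hc hC
      exact h _ _ _ (hm.mono _ _ hw) (hm.map_circ _ _ _ hc) hC
    · intro h w' y' z' hw hc hC
      obtain ⟨w, y, z, h1, h2, h3, h4⟩ := hm.lift_left _ _ _ _ hw hc
      exact D.2.2 h4 (h w y z h1 h2 (C.2.2 h3 hC))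
  map_one := by
    apply Subtype.ext
    ext x
    exact (hm.unit_iff x).symm
  map_mbot := by
    apply Subtype.ext
    ext x
    change FrameOps.neg (g x) ∉ (FrameOps.unit : Set Y) ↔ FrameOps.neg x ∉ (FrameOps.unit : Set X)
    rw [← hm.map_neg, ← hm.unit_iff]

/-! ## Categories -/

/-- The category of DMBI algebras. -/
structure DMBIAlg where
  carrier : Type u
  [alg : DMBIAlgebra carrier]

attribute [instance] DMBIAlg.alg

instance : Category DMBIAlg.{u} where
  Hom A B := DMBIHom A.carrier B.carrier
  id A := DMBIHom.id A.carrier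
  comp f g := f.comp g

/-- The category of CBI algebras. -/
structure CBIAlg extends DMBIAlg.{u} where
  [isCBI : IsCBIAlgebra carrier]

attribute [instance] CBIAlg.isCBI

instance : Category CBIAlg.{u} where
  Hom A B := DMBIHom A.carrier B.carrier
  id A := DMBIHom.id A.carrier
  comp f g := f.comp g

/-- The category of DMBI spaces and continuous DMBI morphisms. -/
structure DMBISp where
  carrier : Type u
  [top : TopologicalSpace carrier]
  [order : PartialOrder carrier]
  [ops : FrameOps carrier]
  [isSpace : IsDMBISpace carrier]

attribute [instance] DMBISp.top DMBISp.order DMBISp.ops DMBISp.isSpace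

/-- Continuous DMBI morphisms. -/
@[ext]
structure DMBISp.Hom (X Y : DMBISp.{u}) where
  toFun : X.carrier → Y.carrier
  continuous : Continuous toFun
  isMorphism : IsDMBIMorphism toFun

theorem IsDMBIMorphism.id (X : Type u) [Preorder X] [FrameOps X] :
    IsDMBIMorphism (fun x : X => x) where
  mono _ _ h := h
  lift_le _ y' h := ⟨y', h, rfl⟩
  map_circ _ _ _ h := h
  lift_circ _ w y z h h' := ⟨w, y, z, h, h', le_rfl, le_rfl⟩
  lift_left _ w y z h h' := ⟨w, y, z, h, h', le_rfl, le_rfl⟩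
  lift_right _ w y z h h' := ⟨w, y, z, h, h', le_rfl, le_rfl⟩
  unit_iff _ := Iff.rfl
  map_neg _ := rfl

theorem IsDMBIMorphism.comp {X : Type u} {Y : Type v} {Z : Type w} [Preorder X] [FrameOps X]
    [Preorder Y] [FrameOps Y] [Preorder Z] [FrameOps Z] {g : X → Y} {h : Y → Z}
    (hg : IsDMBIMorphism g) (hh : IsDMBIMorphism h) : IsDMBIMorphism (fun x => h (g x)) where
  mono _ _ hxy := hh.mono _ _ (hg.mono _ _ hxy)
  lift_le x z hz := by
    obtain ⟨y, hy, rfl⟩ := hh.lift_le _ _ hz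
    obtain ⟨x', hx', rfl⟩ := hg.lift_le _ _ hy
    exact ⟨x', hx', rfl⟩
  map_circ _ _ _ hc := hh.map_circ _ _ _ (hg.map_circ _ _ _ hc)
  lift_circ x w'' y'' z'' hw hc := by
    obtain ⟨w', y', z', h1, h2, h3, h4⟩ := hh.lift_circ _ _ _ _ hw hc
    obtain ⟨w, y, z, k1, k2, k3, k4⟩ := hg.lift_circ _ _ _ _ h1 h2
    exact ⟨w, y, z, k1, k2, h3.trans (hh.mono _ _ k3), h4.trans (hh.mono _ _ k4)⟩
  lift_left x w'' y'' z'' hw hc := by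
    obtain ⟨w', y', z', h1, h2, h3, h4⟩ := hh.lift_left _ _ _ _ hw hc
    obtain ⟨w, y, z, k1, k2, k3, k4⟩ := hg.lift_left _ _ _ _ h1 h2
    exact ⟨w, y, z, k1, k2, h3.trans (hh.mono _ _ k3), (hh.mono _ _ k4).trans h4⟩
  lift_right x w'' y'' z'' hw hc := by
    obtain ⟨w', y', z', h1, h2, h3, h4⟩ := hh.lift_right _ _ _ _ hw hc
    obtain ⟨w, y, z, k1, k2, k3, k4⟩ := hg.lift_right _ _ _ _ h1 h2
    exact ⟨w, y, z, k1, k2, h3.trans (hh.mono _ _ k3), (hh.mono _ _ k4).trans h4⟩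
  unit_iff e := (hg.unit_iff e).trans (hh.unit_iff _)
  map_neg x := by rw [hg.map_neg, hh.map_neg]

instance : Category DMBISp.{u} where
  Hom X Y := DMBISp.Hom X Y
  id X := ⟨fun x => x, continuous_id, IsDMBIMorphism.id X.carrier⟩
  comp f g := ⟨fun x => g.toFun (f.toFun x), g.continuous.comp f.continuous,
    f.isMorphism.comp g.isMorphism⟩

/-- The category of CBI spaces (DMBI spaces whose order is equality) and continuous CBI
morphisms. -/
structure CBISp extends DMBISp.{u} where
  eq_of_le : ∀ x y : carrier, x ≤ y → x = y

/-- Continuous CBI morphisms. -/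
@[ext]
structure CBISp.Hom (X Y : CBISp.{u}) where
  toFun : X.carrier → Y.carrier
  continuous : Continuous toFun
  isMorphism : IsCBIMorphism toFun

theorem CBISp.Hom.isDMBIMorphism {X Y : CBISp.{u}} (g : CBISp.Hom X Y) :
    IsDMBIMorphism g.toFun :=
  (isCBIMorphism_iff X.eq_of_le Y.eq_of_le _).1 g.isMorphism

instance : Category CBISp.{u} where
  Hom X Y := CBISp.Hom X Y
  id X := ⟨fun x => x, continuous_id,
    (isCBIMorphism_iff X.eq_of_le X.eq_of_le _).2 (IsDMBIMorphism.id X.carrier)⟩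
  comp {X Y Z} f g := ⟨fun x => g.toFun (f.toFun x), g.continuous.comp f.continuous,
    (isCBIMorphism_iff X.eq_of_le Z.eq_of_le _).2 (f.isDMBIMorphism.comp g.isDMBIMorphism)⟩

/-- The functor sending a DMBI algebra to its prime filter space and a homomorphism to its inverse
image map; the arguments say that these are DMBI spaces and continuous DMBI morphisms. -/
def prDMBI (hobj : ∀ A : DMBIAlg.{u}, IsDMBISpace (PrimeFilter A.carrier))
    (hmap : ∀ (A B : DMBIAlg.{u}) (f : A ⟶ B),
      Continuous (PrimeFilter.comap f) ∧ IsDMBIMorphism (PrimeFilter.comap f)) :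
    DMBIAlg.{u}ᵒᵖ ⥤ DMBISp.{u} where
  obj A := @DMBISp.mk (PrimeFilter A.unop.carrier) _ _ _ (hobj A.unop)
  map f := ⟨PrimeFilter.comap f.unop, (hmap _ _ f.unop).1, (hmap _ _ f.unop).2⟩

/-- The functor sending a CBI algebra to its prime filter space and a homomorphism to its inverse
image map; the arguments say that these are CBI spaces and continuous CBI morphisms. -/
def prCBI (hobj : ∀ A : CBIAlg.{u}, IsDMBISpace (PrimeFilter A.carrier))
    (heq : ∀ (A : CBIAlg.{u}) (F G : PrimeFilter A.carrier), F ≤ G → F = G)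
    (hmap : ∀ (A B : CBIAlg.{u}) (f : A ⟶ B),
      Continuous (PrimeFilter.comap f) ∧ IsCBIMorphism (PrimeFilter.comap f)) :
    CBIAlg.{u}ᵒᵖ ⥤ CBISp.{u} where
  obj A := ⟨@DMBISp.mk (PrimeFilter A.unop.carrier) _ _ _ (hobj A.unop), heq A.unop⟩
  map f := ⟨PrimeFilter.comap f.unop, (hmap _ _ f.unop).1, (hmap _ _ f.unop).2⟩

/-- The functor sending a DMBI space to its algebra of upwards closed clopen sets and a continuous
morphism to its inverse image map. -/
def clopDMBI : DMBISp.{u}ᵒᵖ ⥤ DMBIAlg.{u} where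
  obj X := ⟨Clop X.unop.carrier⟩
  map g := Clop.comap g.unop.toFun g.unop.continuous g.unop.isMorphism

/-- The functor sending a CBI space to its algebra of clopen sets and a continuous morphism to its
inverse image map. -/
def clopCBI : CBISp.{u}ᵒᵖ ⥤ CBIAlg.{u} where
  obj X := @CBIAlg.mk ⟨Clop X.unop.carrier⟩ (Clop.isCBIAlgebra _ X.unop.eq_of_le)
  map g := Clop.comap g.unop.toFun g.unop.continuous g.unop.isDMBIMorphism

/-! ## Logic -/

/-- Formulas over a set of atomic propositions. -/
inductive Form (P : Type u) : Type u
  | atom : P → Form P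
  | top : Form P
  | bot : Form P
  | mtop : Form P
  | and : Form P → Form P → Form P
  | or : Form P → Form P → Form P
  | imp : Form P → Form P → Form P
  | mneg : Form P → Form P
  | star : Form P → Form P → Form P
  | wand : Form P → Form P → Form P

namespace Form

variable {P : Type u}

/-- Additive negation. -/
def neg (φ : Form P) : Form P := imp φ bot

/-- Multiplicative falsum. -/
def mbot : Form P := mneg mtop

/-- The Hilbert systems: `Proves False φ ψ` is derivability of `φ ⊢ ψ` in the Hilbert system of DMBI
and `Proves True φ ψ` is derivability in that of CBI, which has in addition the rule `dne`. -/
inductive Proves (boolean : Prop) : Form P → Form P → Prop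
  | dne (φ) : boolean → Proves boolean (neg (neg φ)) φ
  | refl (φ) : Proves boolean φ φ
  | top_intro (φ) : Proves boolean φ top
  | bot_elim (φ) : Proves boolean bot φ
  | and_intro {η φ ψ} : Proves boolean η φ → Proves boolean η ψ → Proves boolean η (and φ ψ)
  | and_left {φ ψ₁ ψ₂} : Proves boolean φ (and ψ₁ ψ₂) → Proves boolean φ ψ₁
  | and_right {φ ψ₁ ψ₂} : Proves boolean φ (and ψ₁ ψ₂) → Proves boolean φ ψ₂
  | weaken {η φ ψ} : Proves boolean φ ψ → Proves boolean (and η φ) ψ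
  | or_elim {η φ ψ} : Proves boolean η ψ → Proves boolean φ ψ → Proves boolean (or η φ) ψ
  | or_left {φ ψ₁ ψ₂} : Proves boolean φ ψ₁ → Proves boolean φ (or ψ₁ ψ₂)
  | or_right {φ ψ₁ ψ₂} : Proves boolean φ ψ₂ → Proves boolean φ (or ψ₁ ψ₂)
  | imp_elim {η φ ψ} : Proves boolean η (imp φ ψ) → Proves boolean η φ → Proves boolean η ψ
  | imp_intro {η φ ψ} : Proves boolean (and η φ) ψ → Proves boolean η (imp φ ψ)
  | star_mono {ξ φ η ψ} : Proves boolean ξ φ → Proves boolean η ψ →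
      Proves boolean (star ξ η) (star φ ψ)
  | wand_intro {η φ ψ} : Proves boolean (star η φ) ψ → Proves boolean η (wand φ ψ)
  | wand_elim {ξ η φ ψ} : Proves boolean ξ (wand φ ψ) → Proves boolean η φ →
      Proves boolean (star ξ η) ψ
  | wand_intro' {η φ ψ} : Proves boolean (star η φ) ψ → Proves boolean φ (wand η ψ)
  | wand_elim' {ξ η φ ψ} : Proves boolean ξ (wand φ ψ) → Proves boolean η φ →
      Proves boolean (star η ξ) ψ
  | star_assoc (φ ψ ξ) : Proves boolean (star (star φ ψ) ξ) (star φ (star ψ ξ))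
  | star_comm (φ ψ) : Proves boolean (star φ ψ) (star ψ φ)
  | star_mtop (φ) : Proves boolean (star φ mtop) φ
  | star_mtop' (φ) : Proves boolean φ (star φ mtop)
  | mneg_mneg (φ) : Proves boolean (mneg (mneg φ)) φ
  | mneg_mneg' (φ) : Proves boolean φ (mneg (mneg φ))
  | mneg_wand (φ) : Proves boolean (mneg φ) (wand φ mbot)
  | mneg_wand' (φ) : Proves boolean (wand φ mbot) (mneg φ)

/-- Satisfaction at a point of a frame under a valuation. -/
def Sat {X : Type v} [Preorder X] [FrameOps X] (V : P → Set X) : Form P → X → Prop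
  | atom p, x => x ∈ V p
  | top, _ => True
  | bot, _ => False
  | mtop, x => x ∈ (FrameOps.unit : Set X)
  | and φ ψ, x => Sat V φ x ∧ Sat V ψ x
  | or φ ψ, x => Sat V φ x ∨ Sat V ψ x
  | imp φ ψ, x => ∀ y, x ≤ y → Sat V φ y → Sat V ψ y
  | mneg φ, x => ¬ Sat V φ (FrameOps.neg x)
  | star φ ψ, x => ∃ x' y z, x' ≤ x ∧ x' ∈ FrameOps.circ y z ∧ Sat V φ y ∧ Sat V ψ z
  | wand φ ψ, x => ∀ x' y z, x ≤ x' → z ∈ FrameOps.circ x' y → Sat V φ y → Sat V ψ z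

/-- Entailment over DMBI frames with persistent valuations. -/
def DMBIEntails (φ ψ : Form P) : Prop :=
  ∀ (X : Type u) [Preorder X] [FrameOps X] [IsDMBIFrame X] (V : P → Set X),
    (∀ p, IsUpperSet (V p)) → ∀ x, Sat V φ x → Sat V ψ x

/-- Entailment over CBI frames with arbitrary valuations. -/
def CBIEntails (φ ψ : Form P) : Prop :=
  ∀ (X : Type u) [Preorder X] [FrameOps X] [IsCBIFrame X] (V : P → Set X),
    ∀ x, Sat V φ x → Sat V ψ x

end Form

/-! ## Arithmetic of BI and DMBI algebras -/

namespace BIAlgebra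

variable {A : Type u} [BIAlgebra A]

/-! Everything rests on one extension principle. Since `*` is residuated, it distributes over joins
and annihilates `⊥`; hence for a prime filter `H` and a filter `T`, the elements `a` with `a * b ∉
H` for some `b ∈ T` form an ideal. The prime filter theorem then enlarges a filter whose product
with `T` lies in `H` to a prime filter with the same property (`exists_of_mul_subset`,
`exists_circ_of_mul_subset`). This supplies the units and associativity of the prime filter frame,
the preservation of `*` and of the magic wand by `theta`, and the back conditions for inverse image
maps. For negation, `a ∈ -F` means `~a ∉ F`, so Dual, Involutive and Compatibility reduce to the
order, to `~~a = a` and to `~(a * b) * b ≤ ~a`. In the Boolean case prime filters are maximal, so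
the order is equality.

Satisfaction is evaluation in the complex algebra, which gives soundness. For completeness, an
underivable sequent is refuted at a point of the prime filter frame of the Lindenbaum algebra.

For the duality, ultrafilters show that the prime filter space is compact, and two compactness
arguments identify its upwards closed clopen sets with the sets `{F | a ∈ F}`
(`exists_eq_setOf_mem`), so `theta` is onto. On a space, `eta` is injective by Priestley separation,
surjective by compactness, and reflects composition by the separation axiom for `circ`; being a
continuous bijection from a compact to a Hausdorff space it is a homeomorphism. Naturality and the
triangle identities hold by definition. -/

theorem mul_le_mul_of_le {a b c d : A} (hac : a ≤ c) (hbd : b ≤ d) : a * b ≤ c * d := by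
  have key : ∀ x y z : A, x ≤ y → x * z ≤ y * z := fun x y z h =>
    (mul_le_iff _ _ _).2 (h.trans ((mul_le_iff _ _ _).1 le_rfl))
  refine (key a c b hac).trans ?_
  rw [mul_comm c b, mul_comm c d]
  exact key b d c hbd

theorem bot_mul (a : A) : ⊥ * a = ⊥ :=
  le_bot_iff.1 ((mul_le_iff _ _ _).2 bot_le)

/-- Multiplication by `c` is a left adjoint, so it preserves joins. This half is what makes the set
in `exists_of_mul_subset` closed under joins. -/
theorem sup_mul (a b c : A) : (a ⊔ b) * c ≤ a * c ⊔ b * c :=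
  (mul_le_iff _ _ _).2
    (sup_le ((mul_le_iff _ _ _).1 le_sup_left) ((mul_le_iff _ _ _).1 le_sup_right))

theorem wand_mul_le (a b : A) : wand a b * a ≤ b := (mul_le_iff _ _ _).2 le_rfl

end BIAlgebra

/-- By residuation this is the evaluation of `~(a * b)` at `a * b`. It is the algebraic content of
Compatibility. -/
theorem mneg_mul_mul_le {A : Type u} [DMBIAlgebra A] (a b : A) : mneg (a * b) * b ≤ mneg a := by
  unfold mneg
  rw [← BIAlgebra.mul_le_iff, mul_assoc, mul_comm b a]
  exact BIAlgebra.wand_mul_le _ _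

theorem mneg_one {A : Type u} [DMBIAlgebra A] : mneg (1 : A) = DMBIAlgebra.mbot :=
  DMBIAlgebra.wand_one_mbot

/-! ### Homomorphisms: ranges and inverses. -/

namespace DMBIHom

variable {A : Type u} {B : Type v} [DMBIAlgebra A] [DMBIAlgebra B]

theorem monotone (f : DMBIHom A B) {a b : A} (h : a ≤ b) : f.toFun a ≤ f.toFun b := by
  rw [← inf_eq_left, ← f.map_inf, inf_eq_left.2 h]

theorem map_mneg (f : DMBIHom A B) (a : A) : f.toFun (mneg a) = mneg (f.toFun a) := by
  unfold mneg
  rw [f.map_wand, f.map_mbot]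

theorem isDMBISubalgebra_range (f : DMBIHom A B) : IsDMBISubalgebra (Set.range f.toFun) where
  inf_mem := by
    rintro _ ⟨a, rfl⟩ _ ⟨b, rfl⟩
    exact ⟨_, f.map_inf a b⟩
  sup_mem := by
    rintro _ ⟨a, rfl⟩ _ ⟨b, rfl⟩
    exact ⟨_, f.map_sup a b⟩
  himp_mem := by
    rintro _ ⟨a, rfl⟩ _ ⟨b, rfl⟩
    exact ⟨_, f.map_himp a b⟩
  top_mem := ⟨_, f.map_top⟩
  bot_mem := ⟨_, f.map_bot⟩
  mul_mem := by
    rintro _ ⟨a, rfl⟩ _ ⟨b, rfl⟩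
    exact ⟨_, f.map_mul a b⟩
  wand_mem := by
    rintro _ ⟨a, rfl⟩ _ ⟨b, rfl⟩
    exact ⟨_, f.map_wand a b⟩
  one_mem := ⟨_, f.map_one⟩
  mbot_mem := ⟨_, f.map_mbot⟩

/-- The inverse of a bijective homomorphism. -/
noncomputable def inverse (f : DMBIHom A B) (hf : Function.Bijective f.toFun) : DMBIHom B A where
  toFun := (Equiv.ofBijective _ hf).symm
  map_inf a b := hf.1 (by simp [f.map_inf, Equiv.ofBijective_apply_symm_apply])
  map_sup a b := hf.1 (by simp [f.map_sup, Equiv.ofBijective_apply_symm_apply])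
  map_himp a b := hf.1 (by simp [f.map_himp, Equiv.ofBijective_apply_symm_apply])
  map_top := hf.1 (by simp [f.map_top, Equiv.ofBijective_apply_symm_apply])
  map_bot := hf.1 (by simp [f.map_bot, Equiv.ofBijective_apply_symm_apply])
  map_mul a b := hf.1 (by simp [f.map_mul, Equiv.ofBijective_apply_symm_apply])
  map_wand a b := hf.1 (by simp [f.map_wand, Equiv.ofBijective_apply_symm_apply])
  map_one := hf.1 (by simp [f.map_one, Equiv.ofBijective_apply_symm_apply])
  map_mbot := hf.1 (by simp [f.map_mbot, Equiv.ofBijective_apply_symm_apply])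

theorem comp_inverse (f : DMBIHom A B) (hf : Function.Bijective f.toFun) :
    f.comp (f.inverse hf) = DMBIHom.id A :=
  DMBIHom.ext (funext fun a => (Equiv.ofBijective _ hf).symm_apply_apply a)

theorem inverse_comp (f : DMBIHom A B) (hf : Function.Bijective f.toFun) :
    (f.inverse hf).comp f = DMBIHom.id B :=
  DMBIHom.ext (funext fun a => (Equiv.ofBijective _ hf).apply_symm_apply a)

end DMBIHom

/-! ## Extension of filters to prime filters -/

/-- Nonempty upwards closed subsets of a lattice that are closed under binary meets. -/
structure IsLatticeFilter {A : Type u} [Lattice A] (S : Set A) : Prop where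
  nonempty : S.Nonempty
  mem_of_le : ∀ a b, a ∈ S → a ≤ b → b ∈ S
  inf_mem : ∀ a b, a ∈ S → b ∈ S → a ⊓ b ∈ S

/-- Nonempty downwards closed subsets of a lattice that are closed under binary joins. -/
structure IsLatticeIdeal {A : Type u} [Lattice A] (S : Set A) : Prop where
  nonempty : S.Nonempty
  mem_of_le : ∀ a b, b ∈ S → a ≤ b → a ∈ S
  sup_mem : ∀ a b, a ∈ S → b ∈ S → a ⊔ b ∈ S

theorem isLatticeFilter_Ici {A : Type u} [Lattice A] (a : A) : IsLatticeFilter (Set.Ici a) :=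
  ⟨⟨a, le_rfl⟩, fun _ _ h h' => le_trans h h', fun _ _ h h' => le_inf h h'⟩

theorem isLatticeIdeal_Iic {A : Type u} [Lattice A] (a : A) : IsLatticeIdeal (Set.Iic a) :=
  ⟨⟨a, le_rfl⟩, fun _ _ h h' => le_trans h' h, fun _ _ h h' => sup_le h h'⟩

namespace PrimeFilter

variable {A : Type u} {B : Type v} [DMBIAlgebra A] [DMBIAlgebra B]

theorem isLatticeFilter (F : PrimeFilter A) : IsLatticeFilter F.carrier :=
  ⟨F.nonempty, F.mem_of_le, F.inf_mem⟩

theorem isLatticeIdeal_compl (F : PrimeFilter A) : IsLatticeIdeal F.carrierᶜ :=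
  ⟨⟨⊥, F.bot_notMem⟩, fun _ _ hb hab ha => hb (F.mem_of_le _ _ ha hab),
    fun _ _ ha hb hab => (F.prime _ _ hab).elim ha hb⟩

theorem top_mem (F : PrimeFilter A) : ⊤ ∈ F.carrier := by
  obtain ⟨x, hx⟩ := F.nonempty
  exact F.mem_of_le _ _ hx le_top

theorem inf_mem_iff (F : PrimeFilter A) {a b : A} :
    a ⊓ b ∈ F.carrier ↔ a ∈ F.carrier ∧ b ∈ F.carrier :=
  ⟨fun h => ⟨F.mem_of_le _ _ h inf_le_left, F.mem_of_le _ _ h inf_le_right⟩,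
    fun h => F.inf_mem _ _ h.1 h.2⟩

theorem sup_mem_iff (F : PrimeFilter A) {a b : A} :
    a ⊔ b ∈ F.carrier ↔ a ∈ F.carrier ∨ b ∈ F.carrier :=
  ⟨F.prime a b, fun h => h.elim (fun h => F.mem_of_le _ _ h le_sup_left)
    (fun h => F.mem_of_le _ _ h le_sup_right)⟩

theorem mem_neg {F : PrimeFilter A} {a : A} :
    a ∈ (FrameOps.neg F).carrier ↔ mneg a ∉ F.carrier :=
  not_congr mem_image_mneg

/-- The prime filter theorem: a filter disjoint from an ideal extends to a prime filter disjoint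
from that ideal. -/
theorem exists_of_disjoint {S I : Set A} (hS : IsLatticeFilter S) (hI : IsLatticeIdeal I)
    (h : ∀ a ∈ S, a ∉ I) : ∃ F : PrimeFilter A, S ⊆ F.carrier ∧ ∀ a ∈ F.carrier, a ∉ I := by
  have hS' : Order.IsPFilter S := Order.IsPFilter.of_def hS.nonempty
    (fun a ha b hb => ⟨a ⊓ b, hS.inf_mem _ _ ha hb, inf_le_left, inf_le_right⟩)
    (fun hab ha => hS.mem_of_le _ _ ha hab)
  have hI' : Order.IsIdeal I := ⟨fun a b hba ha => hI.mem_of_le _ _ ha hba, hI.nonempty,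
    fun a ha b hb => ⟨a ⊔ b, hI.sup_mem _ _ ha hb, le_sup_left, le_sup_right⟩⟩
  obtain ⟨J, hJ, hIJ, hSJ⟩ := DistribLattice.prime_ideal_of_disjoint_filter_ideal
    (F := hS'.toPFilter) (I := hI'.toIdeal) (Set.disjoint_left.2 h)
  have hSJ' : S ⊆ (J : Set A)ᶜ := fun a ha => Set.disjoint_left.1 hSJ ha
  -- The filter is the complement of a prime ideal `J` containing `I`: primeness of `J` gives
  -- closure under meets, and closure of `J` under joins gives primeness.
  refine ⟨⟨(J : Set A)ᶜ, hS.nonempty.mono hSJ', fun a b ha hab hb => ha (J.lower hab hb),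
    fun a b ha hb hab => ?_, fun h => h J.bot_mem, fun a b hab => ?_⟩, hSJ',
    fun a ha haI => ha (hIJ haI)⟩
  · exact (hJ.mem_or_mem hab).elim ha hb
  · by_contra hcon
    simp only [Set.mem_compl_iff, not_or, not_not] at hcon
    exact hab (J.sup_mem hcon.1 hcon.2)

theorem exists_of_notMem {S : Set A} (hS : IsLatticeFilter S) {b : A} (hb : b ∉ S) :
    ∃ F : PrimeFilter A, S ⊆ F.carrier ∧ b ∉ F.carrier := by
  obtain ⟨F, hF, hF'⟩ := exists_of_disjoint hS (isLatticeIdeal_Iic b)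
    (fun a ha hab => hb (hS.mem_of_le _ _ ha hab))
  exact ⟨F, hF, fun h => hF' b h le_rfl⟩

theorem exists_of_not_le {a b : A} (h : ¬ a ≤ b) :
    ∃ F : PrimeFilter A, a ∈ F.carrier ∧ b ∉ F.carrier := by
  obtain ⟨F, hF, hb⟩ := exists_of_notMem (isLatticeFilter_Ici a) (b := b) h
  exact ⟨F, hF le_rfl, hb⟩

/-- If the product of two filters is contained in a prime filter, then the first factor may be
extended to a prime filter. -/
theorem exists_of_mul_subset {S T : Set A} (hS : IsLatticeFilter S) (hT : IsLatticeFilter T)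
    (H : PrimeFilter A) (h : ∀ a ∈ S, ∀ b ∈ T, a * b ∈ H.carrier) :
    ∃ F : PrimeFilter A, S ⊆ F.carrier ∧ ∀ a ∈ F.carrier, ∀ b ∈ T, a * b ∈ H.carrier := by
  -- These are the elements that the extension must avoid. For closure under joins, the meet of the
  -- two witnesses in `T` works, because `H` is prime and `*` distributes over joins.
  have hI : IsLatticeIdeal {a : A | ∃ b ∈ T, a * b ∉ H.carrier} := by
    refine ⟨?_, ?_, ?_⟩
    · obtain ⟨b, hb⟩ := hT.nonempty
      refine ⟨⊥, b, hb, ?_⟩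
      rw [BIAlgebra.bot_mul]
      exact H.bot_notMem
    · rintro a a' ⟨b, hb, hab⟩ haa
      exact ⟨b, hb, fun h' => hab (H.mem_of_le _ _ h' (BIAlgebra.mul_le_mul_of_le haa le_rfl))⟩
    · rintro a a' ⟨b, hb, hab⟩ ⟨b', hb', hab'⟩
      refine ⟨b ⊓ b', hT.inf_mem _ _ hb hb', fun h' => ?_⟩
      rcases H.prime _ _ (H.mem_of_le _ _ h' (BIAlgebra.sup_mul _ _ _)) with h1 | h1
      · exact hab (H.mem_of_le _ _ h1 (BIAlgebra.mul_le_mul_of_le le_rfl inf_le_left))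
      · exact hab' (H.mem_of_le _ _ h1 (BIAlgebra.mul_le_mul_of_le le_rfl inf_le_right))
  obtain ⟨F, hSF, hF⟩ := exists_of_disjoint hS hI (fun a ha ⟨b, hb, hab⟩ => hab (h a ha b hb))
  refine ⟨F, hSF, fun a ha b hb => ?_⟩
  by_contra hab
  exact hF a ha ⟨b, hb, hab⟩

theorem exists_of_mul_subset_right {S T : Set A} (hS : IsLatticeFilter S) (hT : IsLatticeFilter T)
    (H : PrimeFilter A) (h : ∀ a ∈ S, ∀ b ∈ T, a * b ∈ H.carrier) :
    ∃ G : PrimeFilter A, T ⊆ G.carrier ∧ ∀ a ∈ S, ∀ b ∈ G.carrier, a * b ∈ H.carrier := by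
  obtain ⟨G, h1, h2⟩ := exists_of_mul_subset hT hS H
    (fun b hb a ha => by rw [mul_comm]; exact h a ha b hb)
  exact ⟨G, h1, fun a ha b hb => by rw [mul_comm]; exact h2 b hb a ha⟩

/-- The factors are extended in turn: once the first has become a prime filter `F`, it serves as the
fixed factor while the second is extended. -/
theorem exists_circ_of_mul_subset {S T : Set A} (hS : IsLatticeFilter S) (hT : IsLatticeFilter T)
    (H : PrimeFilter A) (h : ∀ a ∈ S, ∀ b ∈ T, a * b ∈ H.carrier) :
    ∃ F G : PrimeFilter A, S ⊆ F.carrier ∧ T ⊆ G.carrier ∧ H ∈ FrameOps.circ F G := by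
  obtain ⟨F, hSF, hF⟩ := exists_of_mul_subset hS hT H h
  obtain ⟨G, hTG, hG⟩ := exists_of_mul_subset_right F.isLatticeFilter hT H hF
  exact ⟨F, G, hSF, hTG, hG⟩

/-- The filter generated by the products of elements of two filters. -/
theorem isLatticeFilter_mul {S T : Set A} (hS : IsLatticeFilter S) (hT : IsLatticeFilter T) :
    IsLatticeFilter {c : A | ∃ a ∈ S, ∃ b ∈ T, a * b ≤ c} := by
  refine ⟨?_, ?_, ?_⟩
  · obtain ⟨a, ha⟩ := hS.nonempty
    obtain ⟨b, hb⟩ := hT.nonempty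
    exact ⟨_, a, ha, b, hb, le_rfl⟩
  · rintro c c' ⟨a, ha, b, hb, hc⟩ hcc
    exact ⟨a, ha, b, hb, hc.trans hcc⟩
  · rintro c c' ⟨a, ha, b, hb, hc⟩ ⟨a', ha', b', hb', hc'⟩
    exact ⟨_, hS.inf_mem _ _ ha ha', _, hT.inf_mem _ _ hb hb', le_inf
      ((BIAlgebra.mul_le_mul_of_le inf_le_left inf_le_left).trans hc)
      ((BIAlgebra.mul_le_mul_of_le inf_le_right inf_le_right).trans hc')⟩

/-- The filter generated by the meets of elements of two filters. -/
theorem isLatticeFilter_inf {S T : Set A} (hS : IsLatticeFilter S) (hT : IsLatticeFilter T) :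
    IsLatticeFilter {c : A | ∃ a ∈ S, ∃ b ∈ T, a ⊓ b ≤ c} := by
  refine ⟨?_, ?_, ?_⟩
  · obtain ⟨a, ha⟩ := hS.nonempty
    obtain ⟨b, hb⟩ := hT.nonempty
    exact ⟨_, a, ha, b, hb, le_rfl⟩
  · rintro c c' ⟨a, ha, b, hb, hc⟩ hcc
    exact ⟨a, ha, b, hb, hc.trans hcc⟩
  · rintro c c' ⟨a, ha, b, hb, hc⟩ ⟨a', ha', b', hb', hc'⟩
    exact ⟨_, hS.inf_mem _ _ ha ha', _, hT.inf_mem _ _ hb hb', le_inf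
      ((inf_le_inf inf_le_left inf_le_left).trans hc)
      ((inf_le_inf inf_le_right inf_le_right).trans hc')⟩

/-- The filter generated by the image of a filter under a homomorphism. -/
theorem isLatticeFilter_map (f : DMBIHom A B) {S : Set A} (hS : IsLatticeFilter S) :
    IsLatticeFilter {c : B | ∃ a ∈ S, f.toFun a ≤ c} := by
  refine ⟨?_, ?_, ?_⟩
  · obtain ⟨a, ha⟩ := hS.nonempty
    exact ⟨_, a, ha, le_rfl⟩
  · rintro c c' ⟨a, ha, hc⟩ hcc
    exact ⟨a, ha, hc.trans hcc⟩
  · rintro c c' ⟨a, ha, hc⟩ ⟨a', ha', hc'⟩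
    exact ⟨_, hS.inf_mem _ _ ha ha', le_inf ((f.monotone inf_le_left).trans hc)
      ((f.monotone inf_le_right).trans hc')⟩

/-- The ideal generated by the image of an ideal under a homomorphism. -/
theorem isLatticeIdeal_map (f : DMBIHom A B) {S : Set A} (hS : IsLatticeIdeal S) :
    IsLatticeIdeal {c : B | ∃ a ∈ S, c ≤ f.toFun a} := by
  refine ⟨?_, ?_, ?_⟩
  · obtain ⟨a, ha⟩ := hS.nonempty
    exact ⟨_, a, ha, le_rfl⟩
  · rintro c c' ⟨a, ha, hc⟩ hcc
    exact ⟨a, ha, hcc.trans hc⟩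
  · rintro c c' ⟨a, ha, hc⟩ ⟨a', ha', hc'⟩
    exact ⟨_, hS.sup_mem _ _ ha ha', sup_le (hc.trans (f.monotone le_sup_left))
      (hc'.trans (f.monotone le_sup_right))⟩

/-! ## The prime filter frame -/

scoped instance instIsDMBIFrame : IsDMBIFrame (PrimeFilter A) where
  commutativity F G H h a ha b hb := by
    rw [mul_comm]
    exact h b hb a ha
  closure F G hF hFG := hFG hF
  unit_existence F := by
    -- The principal filter of `1` multiplies `F` into itself, as `a = a * 1 ≤ a * b` for `1 ≤ b`;
    -- its prime extension is the required unit.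
    obtain ⟨E, hE, hF⟩ := exists_of_mul_subset_right F.isLatticeFilter (isLatticeFilter_Ici (1 : A))
      F (fun a ha b hb => F.mem_of_le _ _ ha
        ((mul_one a).ge.trans (BIAlgebra.mul_le_mul_of_le le_rfl hb)))
    exact ⟨E, hE le_rfl, hF⟩
  coherence F G E hE h a ha := by
    rw [← mul_one a]
    exact h a ha 1 hE
  associativity x y z t t' w htt ht hw := by
    -- The filter generated by the products from `y` and `z` multiplies `x` into `w`, so it extends
    -- to a prime `s` with `w ∈ circ x s`. The order slack in Associativity is not needed: `s' = s`
    -- and `w' = w`.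
    obtain ⟨s, hs, hw'⟩ := exists_of_mul_subset_right x.isLatticeFilter
      (isLatticeFilter_mul y.isLatticeFilter z.isLatticeFilter) w (by
        rintro a ha d ⟨b, hb, c, hc, hd⟩
        refine w.mem_of_le _ _ (hw _ (htt (ht a ha b hb)) c hc) ?_
        rw [mul_assoc]
        exact BIAlgebra.mul_le_mul_of_le le_rfl hd)
    exact ⟨s, s, w, le_rfl, fun b hb c hc => hs ⟨b, hb, c, hc, le_rfl⟩, le_rfl, hw'⟩
  dual F G h a ha := mem_neg.2 fun hn => mem_neg.1 ha (h hn)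
  involutive F := by
    apply PrimeFilter.ext
    ext a
    rw [mem_neg, mem_neg, not_not, mneg_mneg]
  -- If `~(a * b)` were in `F`, then `~(a * b) * b`, and with it `~a`, would be in `H`.
  compatibility F G H h a ha b hb := mem_neg.2 fun hn =>
    mem_neg.1 ha (H.mem_of_le _ _ (h _ hn b hb) (mneg_mul_mul_le a b))

theorem compl_mem [IsCBIAlgebra A] {F : PrimeFilter A} {a : A} (ha : a ∉ F.carrier) :
    aᶜ ∈ F.carrier :=
  (F.prime a aᶜ (by rw [IsCBIAlgebra.sup_compl]; exact F.top_mem)).resolve_left ha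

/-- Prime filters of a Boolean algebra are maximal: for `a ∈ G` outside `F`, the complement of `a`
lies in `F`, hence in `G`, which would then contain `⊥`. -/
theorem eq_of_le [IsCBIAlgebra A] (F G : PrimeFilter A) (h : F ≤ G) : F = G := by
  refine le_antisymm h fun a ha => ?_
  by_contra haF
  refine G.bot_notMem (G.mem_of_le _ _ (G.inf_mem _ _ ha (h (compl_mem haF))) ?_)
  rw [inf_compl_self]

scoped instance instIsCBIFrame [IsCBIAlgebra A] : IsCBIFrame (PrimeFilter A) where
  eq_of_le := eq_of_le

/-! ### The sets `{F | a ∈ F}` and the operations of the complex algebra. -/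

theorem setOf_mem_inf (a b : A) : {F : PrimeFilter A | a ⊓ b ∈ F.carrier} =
    {F | a ∈ F.carrier} ∩ {F | b ∈ F.carrier} :=
  Set.ext fun F => F.inf_mem_iff

theorem setOf_mem_sup (a b : A) : {F : PrimeFilter A | a ⊔ b ∈ F.carrier} =
    {F | a ∈ F.carrier} ∪ {F | b ∈ F.carrier} :=
  Set.ext fun F => F.sup_mem_iff

theorem setOf_mem_top : {F : PrimeFilter A | ⊤ ∈ F.carrier} = Set.univ :=
  Set.eq_univ_of_forall top_mem

theorem setOf_mem_bot : {F : PrimeFilter A | ⊥ ∈ F.carrier} = ∅ :=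
  Set.eq_empty_of_forall_notMem bot_notMem

/-- When `a ⇨ b ∉ F`, the filter generated by `F` and `a` omits `b`; a prime extension of it
omitting `b` refutes the implication at `F`. -/
theorem setOf_mem_himp (a b : A) : {F : PrimeFilter A | a ⇨ b ∈ F.carrier} =
    Complex.imp {F | a ∈ F.carrier} {F | b ∈ F.carrier} := by
  ext F
  constructor
  · intro hF G hFG ha
    exact G.mem_of_le _ _ (G.inf_mem _ _ (hFG hF) ha) himp_inf_le
  · intro hF
    by_contra hcon
    obtain ⟨G, hG, hb⟩ := exists_of_notMem
      (isLatticeFilter_inf F.isLatticeFilter (isLatticeFilter_Ici a)) (b := b) (by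
        rintro ⟨c, hc, d, hd, hcd⟩
        exact hcon (F.mem_of_le _ _ hc (le_himp_iff.2 ((inf_le_inf le_rfl hd).trans hcd))))
    refine hb (hF G (fun c hc => hG ⟨c, hc, a, le_rfl, inf_le_left⟩) ?_)
    exact hG ⟨⊤, F.top_mem, a, le_rfl, inf_le_right⟩

/-- The substantial inclusion extends the principal filters of `a` and `b` to prime filters that
compose to `H`. -/
theorem setOf_mem_mul (a b : A) : {F : PrimeFilter A | a * b ∈ F.carrier} =
    Complex.star {F | a ∈ F.carrier} {F | b ∈ F.carrier} := by
  ext H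
  constructor
  · intro hH
    obtain ⟨F, G, hF, hG, h⟩ := exists_circ_of_mul_subset (isLatticeFilter_Ici a)
      (isLatticeFilter_Ici b) H
      (fun c hc d hd => H.mem_of_le _ _ hH (BIAlgebra.mul_le_mul_of_le hc hd))
    exact ⟨H, F, G, le_rfl, h, hF le_rfl, hG le_rfl⟩
  · rintro ⟨H', F, G, hH, h, ha, hb⟩
    exact hH (h a ha b hb)

/-- When the wand is not in `F`, the filter generated by the products of `F` with the principal
filter of `a` omits `b`. It is extended first to a prime `K` omitting `b`; then the principal filter
of `a` is extended to a prime `G` with `K ∈ circ F G`. -/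
theorem setOf_mem_wand (a b : A) : {F : PrimeFilter A | BIAlgebra.wand a b ∈ F.carrier} =
    Complex.wand {F | a ∈ F.carrier} {F | b ∈ F.carrier} := by
  ext F
  constructor
  · intro hF H G K hFH hK ha
    exact K.mem_of_le _ _ (hK _ (hFH hF) a ha) (BIAlgebra.wand_mul_le a b)
  · intro hF
    by_contra hcon
    obtain ⟨K, hK, hb⟩ := exists_of_notMem
      (isLatticeFilter_mul F.isLatticeFilter (isLatticeFilter_Ici a)) (b := b) (by
        rintro ⟨c, hc, d, hd, hcd⟩
        exact hcon (F.mem_of_le _ _ hc ((BIAlgebra.mul_le_iff _ _ _).1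
          ((BIAlgebra.mul_le_mul_of_le le_rfl hd).trans hcd))))
    obtain ⟨G, hG, hc⟩ := exists_of_mul_subset_right F.isLatticeFilter (isLatticeFilter_Ici a) K
      (fun c hc d hd => hK ⟨c, hc, d, hd, le_rfl⟩)
    exact hb (hF F G K le_rfl hc (hG le_rfl))

theorem setOf_mem_mbot : {F : PrimeFilter A | DMBIAlgebra.mbot ∈ F.carrier} =
    Complex.falsum (PrimeFilter A) := by
  ext F
  change _ ↔ ¬ (1 ∈ (FrameOps.neg F).carrier)
  rw [mem_neg, not_not, mneg_one]
  rfl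

theorem setOf_mem_injective :
    Function.Injective fun a : A => {F : PrimeFilter A | a ∈ F.carrier} := by
  have key : ∀ a b : A,
      {F : PrimeFilter A | a ∈ F.carrier} = {F : PrimeFilter A | b ∈ F.carrier} → a ≤ b := by
    intro a b hab
    by_contra hle
    obtain ⟨F, ha, hb⟩ := exists_of_not_le hle
    exact hb (hab.subset ha)
  exact fun a b hab => le_antisymm (key a b hab) (key b a hab.symm)

end PrimeFilter

section primeFilterFrame

open scoped PrimeFilter

/-- The representation map as a homomorphism into the complex algebra of the prime filter frame. -/
def thetaHom (A : Type u) [DMBIAlgebra A] : DMBIHom A (Com (PrimeFilter A)) where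
  toFun := theta A
  map_inf a b := Subtype.ext (PrimeFilter.setOf_mem_inf a b)
  map_sup a b := Subtype.ext (PrimeFilter.setOf_mem_sup a b)
  map_himp a b := Subtype.ext (PrimeFilter.setOf_mem_himp a b)
  map_top := Subtype.ext PrimeFilter.setOf_mem_top
  map_bot := Subtype.ext PrimeFilter.setOf_mem_bot
  map_mul a b := Subtype.ext (PrimeFilter.setOf_mem_mul a b)
  map_wand a b := Subtype.ext (PrimeFilter.setOf_mem_wand a b)
  map_one := rfl
  map_mbot := Subtype.ext PrimeFilter.setOf_mem_mbot

theorem thetaHom_injective (A : Type u) [DMBIAlgebra A] :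
    Function.Injective (thetaHom A).toFun :=
  fun _ _ h => PrimeFilter.setOf_mem_injective (congrArg Subtype.val h)

theorem exists_theta_embedding (A : Type u) [DMBIAlgebra A] :
    ∃ φ : DMBIHom A (Com (PrimeFilter A)), φ.toFun = theta A ∧ Function.Injective φ.toFun ∧
      IsDMBISubalgebra (Set.range φ.toFun) :=
  ⟨thetaHom A, rfl, thetaHom_injective A, (thetaHom A).isDMBISubalgebra_range⟩

/-! ## The prime filter space -/

namespace PrimeFilter

variable {A : Type u} {B : Type v} [DMBIAlgebra A] [DMBIAlgebra B]

theorem isClopen_setOf_mem (a : A) : IsClopen {F : PrimeFilter A | a ∈ F.carrier} :=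
  ⟨⟨TopologicalSpace.isOpen_generateFrom_of_mem ⟨a, Or.inr rfl⟩⟩,
    TopologicalSpace.isOpen_generateFrom_of_mem ⟨a, Or.inl rfl⟩⟩

theorem isUpperSet_setOf_mem (a : A) : IsUpperSet {F : PrimeFilter A | a ∈ F.carrier} :=
  fun _ _ hFG hF => hFG hF

/-- Finite intersections of subbasic sets collapse to a single difference, because meets and joins
of elements correspond to intersections and unions; so these differences form a base. -/
theorem exists_basic_subset {S : Set (PrimeFilter A)} (hS : IsOpen S) {F : PrimeFilter A}
    (hF : F ∈ S) : ∃ a ∈ F.carrier, ∃ b, b ∉ F.carrier ∧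
      {G : PrimeFilter A | a ∈ G.carrier} \ {G | b ∈ G.carrier} ⊆ S := by
  induction hS with
  | basic s hs =>
    obtain ⟨a, rfl | rfl⟩ := hs
    · exact ⟨a, hF, ⊥, F.bot_notMem, fun G hG => hG.1⟩
    · exact ⟨⊤, F.top_mem, a, hF, fun G hG => hG.2⟩
  | univ => exact ⟨⊤, F.top_mem, ⊥, F.bot_notMem, Set.subset_univ _⟩
  | inter s t _ _ ihs iht =>
    obtain ⟨a, ha, b, hb, h⟩ := ihs hF.1
    obtain ⟨a', ha', b', hb', h'⟩ := iht hF.2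
    refine ⟨a ⊓ a', F.inf_mem _ _ ha ha', b ⊔ b', fun hbb => (F.prime _ _ hbb).elim hb hb', ?_⟩
    rintro G ⟨hG, hG'⟩
    exact ⟨h ⟨(G.inf_mem_iff.1 hG).1, fun hn => hG' (G.sup_mem_iff.2 (Or.inl hn))⟩,
      h' ⟨(G.inf_mem_iff.1 hG).2, fun hn => hG' (G.sup_mem_iff.2 (Or.inr hn))⟩⟩
  | sUnion S _ ih =>
    obtain ⟨s, hs, hFs⟩ := hF
    obtain ⟨a, ha, b, hb, h⟩ := ih s hs hFs
    exact ⟨a, ha, b, hb, h.trans (Set.subset_sUnion_of_mem hs)⟩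

/-- The limit of an ultrafilter on the prime filter space. -/
def ofUltrafilter (U : Ultrafilter (PrimeFilter A)) : PrimeFilter A where
  carrier := {a | {F : PrimeFilter A | a ∈ F.carrier} ∈ U}
  nonempty := ⟨⊤, by
    rw [Set.mem_ofPred_eq, setOf_mem_top]
    exact Filter.univ_mem⟩
  mem_of_le a b ha hab := Filter.mem_of_superset ha fun F hF => F.mem_of_le _ _ hF hab
  inf_mem a b ha hb := by
    rw [Set.mem_ofPred_eq, setOf_mem_inf]
    exact Filter.inter_mem ha hb
  bot_notMem := by
    rw [Set.mem_ofPred_eq, setOf_mem_bot]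
    exact U.empty_notMem
  prime a b hab := by
    rw [Set.mem_ofPred_eq, setOf_mem_sup] at hab
    exact Ultrafilter.union_mem_iff.1 hab

-- Every ultrafilter converges to `ofUltrafilter U`. This need only be tested on the subbase, where
-- it is the definition of that filter, or its negation for complements.
scoped instance instCompactSpace : CompactSpace (PrimeFilter A) where
  isCompact_univ := by
    rw [isCompact_iff_ultrafilter_le_nhds]
    intro U _
    refine ⟨ofUltrafilter U, Set.mem_univ _, ?_⟩
    rw [TopologicalSpace.nhds_generateFrom]
    refine le_iInf₂ fun s hs => ?_
    rw [Filter.le_principal_iff]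
    obtain ⟨hU, a, rfl | rfl⟩ := hs
    · exact hU
    · exact Ultrafilter.compl_mem_iff_notMem.2 hU

scoped instance instPriestleySpace : PriestleySpace (PrimeFilter A) where
  priestley {F G} h := by
    obtain ⟨a, ha, hb⟩ := Set.not_subset.1 h
    exact ⟨_, isClopen_setOf_mem a, isUpperSet_setOf_mem a, ha, hb⟩

theorem imp_eq_compl_lowerClosure {X : Type u} [Preorder X] (S T : Set X) :
    Complex.imp S T = (lowerClosure (S \ T) : Set X)ᶜ := by
  ext x
  simp only [Complex.imp, Set.mem_ofPred_eq, Set.mem_compl_iff, SetLike.mem_coe,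
    mem_lowerClosure, Set.mem_sdiff, not_exists, not_and]
  exact ⟨fun h y hy hxy => hy.2 (h y hxy hy.1),
    fun h y hxy hyS => by_contra fun hyT => h y ⟨hyS, hyT⟩ hxy⟩

-- Down-sets commute with unions, and a clopen set is by compactness a finite union of basic
-- differences. The down-set of such a difference is the complement of `{F | a ⇨ b ∈ F}`, hence
-- clopen.
scoped instance instIsEsakiaSpace : IsEsakiaSpace (PrimeFilter A) where
  isClopen_lowerClosure C hC := by
    -- The statement is loosened to a set `D` between `s` and `C`, so that it passes to subsets of
    -- `s` as compact induction requires; at `s = C` it forces `D = C`.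
    obtain ⟨D, hCD, hDC, hD⟩ : ∃ D : Set (PrimeFilter A), C ⊆ D ∧ D ⊆ C ∧
        IsClopen (lowerClosure D : Set (PrimeFilter A)) := by
      refine IsCompact.induction_on (p := fun s => ∃ D : Set (PrimeFilter A), s ⊆ D ∧ D ⊆ C ∧
        IsClopen (lowerClosure D : Set (PrimeFilter A))) hC.1.isCompact ?_ ?_ ?_ ?_
      · exact ⟨∅, subset_rfl, Set.empty_subset _, by simp [isClopen_empty]⟩
      · rintro s t hst ⟨D, h1, h2⟩
        exact ⟨D, hst.trans h1, h2⟩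
      · rintro s t ⟨D, h1, h2, h3⟩ ⟨D', h1', h2', h3'⟩
        refine ⟨D ∪ D', Set.union_subset_union h1 h1', Set.union_subset h2 h2', ?_⟩
        rw [lowerClosure_union, LowerSet.coe_sup]
        exact h3.union h3'
      · intro F hF
        obtain ⟨a, ha, b, hb, h⟩ := exists_basic_subset hC.2 hF
        refine ⟨_, mem_nhdsWithin_of_mem_nhds
          (((isClopen_setOf_mem a).diff (isClopen_setOf_mem b)).2.mem_nhds ⟨ha, hb⟩),
          _, subset_rfl, h, ?_⟩
        rw [← isClopen_compl_iff, ← imp_eq_compl_lowerClosure, ← setOf_mem_himp]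
        exact isClopen_setOf_mem _
    rwa [hCD.antisymm hDC]

/-- The upwards closed clopen sets of the prime filter space are those of the form
`{F | a ∈ F}`. -/
theorem exists_eq_setOf_mem {S : Set (PrimeFilter A)} (hS : IsClopen S) (hS' : IsUpperSet S) :
    ∃ a : A, S = {F | a ∈ F.carrier} := by
  -- First use of compactness: the sets `{G | a ∈ G}` with `a ∈ F` are directed and intersect in the
  -- up-set of `F`, which lies in `S`, so one of them already misses the compact complement of `S`.
  have key : ∀ F ∈ S, ∃ a ∈ F.carrier, {G : PrimeFilter A | a ∈ G.carrier} ⊆ S := by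
    intro F hF
    have : Nonempty F.carrier := F.nonempty.to_subtype
    obtain ⟨a, ha⟩ := hS.compl.1.isCompact.elim_directed_family_closed
      (fun a : F.carrier => {G : PrimeFilter A | a.1 ∈ G.carrier})
      (fun a => (isClopen_setOf_mem _).1) (by
        rw [Set.eq_empty_iff_forall_notMem]
        rintro G ⟨hG, hFG⟩
        exact hG (hS' (fun a ha => Set.mem_iInter.1 hFG ⟨a, ha⟩) hF))
      (fun a b => ⟨⟨_, F.inf_mem _ _ a.2 b.2⟩, fun G hG => (G.inf_mem_iff.1 hG).1,
        fun G hG => (G.inf_mem_iff.1 hG).2⟩)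
    refine ⟨a, a.2, fun G hG => ?_⟩
    by_contra hGS
    exact ha.subset ⟨hGS, hG⟩
  have : Nonempty {a : A // {G : PrimeFilter A | a ∈ G.carrier} ⊆ S} :=
    ⟨⟨⊥, by rw [setOf_mem_bot]; exact Set.empty_subset _⟩⟩
  -- Second use: `S` is covered by the sets of this form that it contains. They are directed under
  -- joins, so a single one is all of `S`.
  obtain ⟨a, ha⟩ := hS.1.isCompact.elim_directed_cover
    (fun a : {a : A // {G : PrimeFilter A | a ∈ G.carrier} ⊆ S} =>
      {G : PrimeFilter A | a.1 ∈ G.carrier})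
    (fun a => (isClopen_setOf_mem _).2)
    (fun F hF => by
      obtain ⟨a, ha, haS⟩ := key F hF
      exact Set.mem_iUnion.2 ⟨⟨a, haS⟩, ha⟩)
    (fun a b => ⟨⟨a.1 ⊔ b.1, by rw [setOf_mem_sup]; exact Set.union_subset a.2 b.2⟩,
      fun G hG => G.sup_mem_iff.2 (Or.inl hG), fun G hG => G.sup_mem_iff.2 (Or.inr hG)⟩)
  exact ⟨a, ha.antisymm a.2⟩

scoped instance instIsDMBISpace : IsDMBISpace (PrimeFilter A) where
  isClopen_star C D hC hC' hD hD' := by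
    obtain ⟨a, rfl⟩ := exists_eq_setOf_mem hC hC'
    obtain ⟨b, rfl⟩ := exists_eq_setOf_mem hD hD'
    rw [← setOf_mem_mul]
    exact isClopen_setOf_mem _
  isClopen_wand C D hC hC' hD hD' := by
    obtain ⟨a, rfl⟩ := exists_eq_setOf_mem hC hC'
    obtain ⟨b, rfl⟩ := exists_eq_setOf_mem hD hD'
    rw [← setOf_mem_wand]
    exact isClopen_setOf_mem _
  exists_of_notMem_circ H F G h := by
    change ¬ ∀ a ∈ F.carrier, ∀ b ∈ G.carrier, a * b ∈ H.carrier at h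
    push Not at h
    obtain ⟨a, ha, b, hb, hab⟩ := h
    refine ⟨_, _, isClopen_setOf_mem a, isUpperSet_setOf_mem a, isClopen_setOf_mem b,
      isUpperSet_setOf_mem b, ha, hb, ?_⟩
    rw [← setOf_mem_mul]
    exact hab
  isClopen_unit := isClopen_setOf_mem 1
  continuous_neg := by
    have key : ∀ a : A, IsClopen (FrameOps.neg ⁻¹' {F : PrimeFilter A | a ∈ F.carrier}) := by
      intro a
      have h : FrameOps.neg ⁻¹' {F : PrimeFilter A | a ∈ F.carrier} =
          {F : PrimeFilter A | mneg a ∈ F.carrier}ᶜ := Set.ext fun F => mem_neg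
      rw [h]
      exact (isClopen_setOf_mem _).compl
    refine continuous_generateFrom_iff.2 ?_
    rintro _ ⟨a, rfl | rfl⟩
    · exact (key a).2
    · exact (key a).compl.2

/-! ## Inverse image maps between prime filter spaces -/

theorem continuous_comap (f : DMBIHom A B) : Continuous (comap f) := by
  refine continuous_generateFrom_iff.2 ?_
  rintro _ ⟨a, rfl | rfl⟩
  · exact (isClopen_setOf_mem (f.toFun a)).2
  · exact (isClopen_setOf_mem (f.toFun a)).compl.2

/-- The back conditions ask for prime filters of `B` that contain the image of one prime filter of
`A` and, where an upper bound is wanted, avoid the image of the complement of another. Disjointness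
is pulled back to `A` because `f` preserves `⇨`, `*` and the wand. -/
theorem isDMBIMorphism_comap (f : DMBIHom A B) : IsDMBIMorphism (comap f) where
  mono F G h a ha := h ha
  lift_le F G' h := by
    obtain ⟨G, hG, hG'⟩ := exists_of_disjoint
      (isLatticeFilter_inf F.isLatticeFilter (isLatticeFilter_map f G'.isLatticeFilter))
      (isLatticeIdeal_map f G'.isLatticeIdeal_compl) (by
        rintro c ⟨d, hd, e, ⟨a, ha, hae⟩, hc⟩ ⟨b, hb, hcb⟩
        have h1 : d ≤ f.toFun (a ⇨ b) := by
          rw [f.map_himp, le_himp_iff]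
          exact (inf_le_inf le_rfl hae).trans (hc.trans hcb)
        exact hb (G'.mem_of_le _ _ (G'.inf_mem _ _ (h (F.mem_of_le _ _ hd h1)) ha) himp_inf_le))
    obtain ⟨a', ha'⟩ := G'.nonempty
    -- Avoiding the image of the complement of `G'` gives one inclusion between the inverse image of
    -- `G` and `G'`; containing the image of `G'` gives the other.
    refine ⟨G, fun d hd => hG ⟨d, hd, _, ⟨a', ha', le_rfl⟩, inf_le_left⟩, le_antisymm ?_ ?_⟩
    · intro a ha
      by_contra haG
      exact hG' _ ha ⟨a, haG, le_rfl⟩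
    · intro a ha
      exact hG ⟨⊤, F.top_mem, _, ⟨a, ha, le_rfl⟩, inf_le_right⟩
  map_circ H F G h a ha b hb := by
    change f.toFun (a * b) ∈ H.carrier
    rw [f.map_mul]
    exact h _ ha _ hb
  lift_circ H H' F' G' hH h := by
    obtain ⟨F, G, hF, hG, hc⟩ := exists_circ_of_mul_subset
      (isLatticeFilter_map f F'.isLatticeFilter) (isLatticeFilter_map f G'.isLatticeFilter) H (by
        rintro c ⟨a, ha, hac⟩ d ⟨b, hb, hbd⟩
        refine H.mem_of_le _ _ (hH (h a ha b hb)) ?_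
        rw [f.map_mul]
        exact BIAlgebra.mul_le_mul_of_le hac hbd)
    exact ⟨H, F, G, le_rfl, hc, fun a ha => hF ⟨a, ha, le_rfl⟩, fun a ha => hG ⟨a, ha, le_rfl⟩⟩
  lift_left F H' G' K' hF h := by
    -- If the filter and the ideal met, some wand from `a ∈ G'` to `b ∉ K'` would lie in the inverse
    -- image of `F`, hence in `H'`, and composition would put `b` in `K'`. With `K` fixed, the
    -- second factor is then extended to `G`.
    obtain ⟨K, hK, hK'⟩ := exists_of_disjoint
      (isLatticeFilter_mul F.isLatticeFilter (isLatticeFilter_map f G'.isLatticeFilter))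
      (isLatticeIdeal_map f K'.isLatticeIdeal_compl) (by
        rintro c ⟨d, hd, e, ⟨a, ha, hae⟩, hc⟩ ⟨b, hb, hcb⟩
        have h1 : d ≤ f.toFun (BIAlgebra.wand a b) := by
          rw [f.map_wand, ← BIAlgebra.mul_le_iff]
          exact (BIAlgebra.mul_le_mul_of_le le_rfl hae).trans (hc.trans hcb)
        exact hb (K'.mem_of_le _ _ (h _ (hF (F.mem_of_le _ _ hd h1)) a ha)
          (BIAlgebra.wand_mul_le a b)))
    obtain ⟨G, hG, hc⟩ := exists_of_mul_subset_right F.isLatticeFilter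
      (isLatticeFilter_map f G'.isLatticeFilter) K
      (fun c hc d hd => hK ⟨c, hc, d, hd, le_rfl⟩)
    refine ⟨F, G, K, le_rfl, hc, fun a ha => hG ⟨a, ha, le_rfl⟩, fun a ha => ?_⟩
    by_contra haK
    exact hK' _ ha ⟨a, haK, le_rfl⟩
  lift_right F H' G' K' hF h := by
    obtain ⟨K, hK, hK'⟩ := exists_of_disjoint
      (isLatticeFilter_mul F.isLatticeFilter (isLatticeFilter_map f G'.isLatticeFilter))
      (isLatticeIdeal_map f K'.isLatticeIdeal_compl) (by
        rintro c ⟨d, hd, e, ⟨a, ha, hae⟩, hc⟩ ⟨b, hb, hcb⟩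
        have h1 : d ≤ f.toFun (BIAlgebra.wand a b) := by
          rw [f.map_wand, ← BIAlgebra.mul_le_iff]
          exact (BIAlgebra.mul_le_mul_of_le le_rfl hae).trans (hc.trans hcb)
        exact hb (K'.mem_of_le _ _ (h a ha _ (hF (F.mem_of_le _ _ hd h1)))
          ((mul_comm _ _).le.trans (BIAlgebra.wand_mul_le a b))))
    obtain ⟨G, hG, hc⟩ := exists_of_mul_subset_right F.isLatticeFilter
      (isLatticeFilter_map f G'.isLatticeFilter) K
      (fun c hc d hd => hK ⟨c, hc, d, hd, le_rfl⟩)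
    refine ⟨F, G, K, le_rfl, IsBIFrame.commutativity _ _ _ hc,
      fun a ha => hG ⟨a, ha, le_rfl⟩, fun a ha => ?_⟩
    by_contra haK
    exact hK' _ ha ⟨a, haK, le_rfl⟩
  unit_iff F := by
    change 1 ∈ F.carrier ↔ f.toFun 1 ∈ F.carrier
    rw [f.map_one]
  map_neg F := by
    apply PrimeFilter.ext
    ext a
    change f.toFun a ∈ (FrameOps.neg F).carrier ↔ _
    rw [mem_neg, mem_neg, ← f.map_mneg]
    rfl

end PrimeFilter

/-- The representation map as a homomorphism into the algebra of upwards closed clopen sets of the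
prime filter space. -/
def thetaClop (A : Type u) [DMBIAlgebra A] : DMBIHom A (Clop (PrimeFilter A)) where
  toFun a := ⟨{F | a ∈ F.carrier}, PrimeFilter.isClopen_setOf_mem a,
    PrimeFilter.isUpperSet_setOf_mem a⟩
  map_inf a b := Subtype.ext (PrimeFilter.setOf_mem_inf a b)
  map_sup a b := Subtype.ext (PrimeFilter.setOf_mem_sup a b)
  map_himp a b := Subtype.ext (PrimeFilter.setOf_mem_himp a b)
  map_top := Subtype.ext PrimeFilter.setOf_mem_top
  map_bot := Subtype.ext PrimeFilter.setOf_mem_bot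
  map_mul a b := Subtype.ext (PrimeFilter.setOf_mem_mul a b)
  map_wand a b := Subtype.ext (PrimeFilter.setOf_mem_wand a b)
  map_one := rfl
  map_mbot := Subtype.ext PrimeFilter.setOf_mem_mbot

theorem thetaClop_bijective (A : Type u) [DMBIAlgebra A] :
    Function.Bijective (thetaClop A).toFun := by
  constructor
  · exact fun _ _ h => PrimeFilter.setOf_mem_injective (congrArg Subtype.val h)
  · rintro ⟨S, hS, hS'⟩
    obtain ⟨a, rfl⟩ := PrimeFilter.exists_eq_setOf_mem hS hS'
    exact ⟨a, rfl⟩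

/-! ## The unit of the duality on spaces -/

section eta

variable (X : Type u) [TopologicalSpace X] [PartialOrder X] [FrameOps X] [IsDMBISpace X]

/-- The map sending a point of a space to the prime filter of the upwards closed clopen sets
containing it. -/
def eta (x : X) : PrimeFilter (Clop X) where
  carrier := {C | x ∈ C.1}
  nonempty := ⟨⊤, Set.mem_univ x⟩
  mem_of_le _ _ ha hab := hab ha
  inf_mem _ _ ha hb := ⟨ha, hb⟩
  bot_notMem h := h
  prime _ _ h := h

theorem eta_le_eta_iff {x y : X} : eta X x ≤ eta X y ↔ x ≤ y := by
  constructor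
  · intro h
    by_contra hxy
    obtain ⟨U, hU, hU', hx, hy⟩ := exists_isClopen_upper_of_not_le hxy
    exact hy (h (show (⟨U, hU, hU'⟩ : Clop X) ∈ (eta X x).carrier from hx))
  · exact fun hxy C hC => C.2.2 hxy hC

theorem eta_injective : Function.Injective (eta X) := fun _ _ h =>
  le_antisymm ((eta_le_eta_iff X).1 h.le) ((eta_le_eta_iff X).1 h.ge)

/-- The sets `C \ D` with `C ∈ F` and `D ∉ F` are nonempty, since `C ⊆ D` would force `D ∈ F`; they
are closed and directed, so by compactness they share a point, and its image is `F`. -/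
theorem eta_surjective : Function.Surjective (eta X) := by
  intro F
  have : Nonempty (F.carrier × (F.carrierᶜ : Set (Clop X))) :=
    ⟨⟨⊤, F.top_mem⟩, ⟨⊥, F.bot_notMem⟩⟩
  have hcl : ∀ p : F.carrier × (F.carrierᶜ : Set (Clop X)),
      IsClopen ((p.1.1.1 : Set X) \ p.2.1.1) := fun p => p.1.1.2.1.diff p.2.1.2.1
  obtain ⟨x, hx⟩ := IsCompact.nonempty_iInter_of_directed_nonempty_isCompact_isClosed
    (fun p : F.carrier × (F.carrierᶜ : Set (Clop X)) => (p.1.1.1 : Set X) \ p.2.1.1)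
    (fun p q => ⟨⟨⟨_, F.inf_mem _ _ p.1.2 q.1.2⟩,
      ⟨_, F.isLatticeIdeal_compl.sup_mem _ _ p.2.2 q.2.2⟩⟩,
      fun y hy => ⟨hy.1.1, fun hn => hy.2 (Or.inl hn)⟩,
      fun y hy => ⟨hy.1.2, fun hn => hy.2 (Or.inr hn)⟩⟩)
    (fun p => by
      rw [Set.sdiff_nonempty]
      exact fun h => p.2.2 (F.mem_of_le _ _ p.1.2 h))
    (fun p => (hcl p).1.isCompact) (fun p => (hcl p).1)
  refine ⟨x, PrimeFilter.ext (Set.ext fun C => ⟨fun hC => ?_, fun hC => ?_⟩)⟩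
  · by_contra hn
    exact (Set.mem_iInter.1 hx (⟨⊤, F.top_mem⟩, ⟨C, hn⟩)).2 hC
  · exact (Set.mem_iInter.1 hx (⟨C, hC⟩, ⟨⊥, F.bot_notMem⟩)).1

theorem continuous_eta : Continuous (eta X) := by
  refine continuous_generateFrom_iff.2 ?_
  rintro _ ⟨C, rfl | rfl⟩
  · exact C.2.1.2
  · exact C.2.1.compl.2

/-- Reflection is what the separation axiom for `circ` provides. -/
theorem eta_mem_circ_iff {x y z : X} :
    eta X x ∈ FrameOps.circ (eta X y) (eta X z) ↔ x ∈ FrameOps.circ y z := by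
  constructor
  · intro h
    by_contra hx
    obtain ⟨C, D, hC, hC', hD, hD', hy, hz, hn⟩ := IsDMBISpace.exists_of_notMem_circ x y z hx
    exact hn (h (⟨C, hC, hC'⟩ : Clop X) hy (⟨D, hD, hD'⟩ : Clop X) hz)
  · exact fun h C hC D hD => ⟨x, y, z, le_rfl, h, hC, hD⟩

/-- By `Complex.wand_falsum`, `~C` consists of the points whose negation is outside `C`. -/
theorem eta_neg (x : X) : eta X (FrameOps.neg x) = FrameOps.neg (eta X x) := by
  apply PrimeFilter.ext
  ext C
  rw [PrimeFilter.mem_neg]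
  change _ ↔ x ∉ Complex.wand C.1 (Complex.falsum X)
  rw [Complex.wand_falsum C.2.2]
  exact not_not.symm

end eta

/-- Bijections preserving and reflecting the structure of a frame are morphisms. -/
theorem IsDMBIMorphism.of_surjective {X : Type u} {Y : Type v} [Preorder X] [FrameOps X]
    [Preorder Y] [FrameOps Y] {g : X → Y} (hg : Function.Surjective g)
    (hle : ∀ x y, g x ≤ g y ↔ x ≤ y)
    (hcirc : ∀ x y z, g x ∈ FrameOps.circ (g y) (g z) ↔ x ∈ FrameOps.circ y z)
    (hunit : ∀ e, e ∈ (FrameOps.unit : Set X) ↔ g e ∈ (FrameOps.unit : Set Y))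
    (hneg : ∀ x, g (FrameOps.neg x) = FrameOps.neg (g x)) : IsDMBIMorphism g where
  mono x y := (hle x y).2
  lift_le x y' h := by
    obtain ⟨y, rfl⟩ := hg y'
    exact ⟨y, (hle _ _).1 h, rfl⟩
  map_circ x y z := (hcirc x y z).2
  lift_circ x w' y' z' h hc := by
    obtain ⟨w, rfl⟩ := hg w'
    obtain ⟨y, rfl⟩ := hg y'
    obtain ⟨z, rfl⟩ := hg z'
    exact ⟨w, y, z, (hle _ _).1 h, (hcirc _ _ _).1 hc, le_rfl, le_rfl⟩
  lift_left x w' y' z' h hc := by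
    obtain ⟨w, rfl⟩ := hg w'
    obtain ⟨y, rfl⟩ := hg y'
    obtain ⟨z, rfl⟩ := hg z'
    exact ⟨w, y, z, (hle _ _).1 h, (hcirc _ _ _).1 hc, le_rfl, le_rfl⟩
  lift_right x w' y' z' h hc := by
    obtain ⟨w, rfl⟩ := hg w'
    obtain ⟨y, rfl⟩ := hg y'
    obtain ⟨z, rfl⟩ := hg z'
    exact ⟨w, y, z, (hle _ _).1 h, (hcirc _ _ _).1 hc, le_rfl, le_rfl⟩
  unit_iff := hunit
  map_neg := hneg

section eta

variable (X : Type u) [TopologicalSpace X] [PartialOrder X] [FrameOps X] [IsDMBISpace X]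

theorem isDMBIMorphism_eta : IsDMBIMorphism (eta X) :=
  .of_surjective (eta_surjective X) (fun _ _ => eta_le_eta_iff X) (fun _ _ _ => eta_mem_circ_iff X)
    (fun _ => Iff.rfl) (eta_neg X)

/-- The homeomorphism of a space with the prime filter space of its algebra of upwards closed clopen
sets. -/
noncomputable def etaHomeomorph : X ≃ₜ PrimeFilter (Clop X) :=
  -- The target is Hausdorff because it is a Priestley space.
  Continuous.homeoOfEquivCompactToT2
    (f := Equiv.ofBijective (eta X) ⟨eta_injective X, eta_surjective X⟩) (continuous_eta X)

theorem eta_etaHomeomorph_symm (F : PrimeFilter (Clop X)) :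
    eta X ((etaHomeomorph X).symm F) = F := (etaHomeomorph X).apply_symm_apply F

theorem isDMBIMorphism_etaHomeomorph_symm : IsDMBIMorphism (etaHomeomorph X).symm :=
  .of_surjective (etaHomeomorph X).symm.surjective
    (fun F G => by rw [← eta_le_eta_iff X, eta_etaHomeomorph_symm, eta_etaHomeomorph_symm])
    (fun F G H => by
      rw [← eta_mem_circ_iff X, eta_etaHomeomorph_symm, eta_etaHomeomorph_symm,
        eta_etaHomeomorph_symm])
    (fun F => by
      rw [(isDMBIMorphism_eta X).unit_iff, eta_etaHomeomorph_symm])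
    (fun F => eta_injective X (by
      rw [eta_neg, eta_etaHomeomorph_symm, eta_etaHomeomorph_symm]))

end eta

/-! ## Soundness and completeness -/

namespace Form

variable {P : Type u}

/-- The value of a formula in an algebra. -/
def eval {A : Type v} [DMBIAlgebra A] (V : P → A) : Form P → A
  | atom p => V p
  | top => ⊤
  | bot => ⊥
  | mtop => 1
  | and φ ψ => eval V φ ⊓ eval V ψ
  | or φ ψ => eval V φ ⊔ eval V ψ
  | imp φ ψ => eval V φ ⇨ eval V ψ
  | mneg φ => _root_.mneg (eval V φ)
  | star φ ψ => eval V φ * eval V ψ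
  | wand φ ψ => BIAlgebra.wand (eval V φ) (eval V ψ)

theorem eval_map {A : Type v} {B : Type w} [DMBIAlgebra A] [DMBIAlgebra B] (f : DMBIHom A B)
    (V : P → A) (φ : Form P) : eval (fun p => f.toFun (V p)) φ = f.toFun (eval V φ) := by
  induction φ with
  | atom p => rfl
  | top => exact f.map_top.symm
  | bot => exact f.map_bot.symm
  | mtop => exact f.map_one.symm
  | and φ ψ ih ih' => rw [eval, eval, ih, ih', f.map_inf]
  | or φ ψ ih ih' => rw [eval, eval, ih, ih', f.map_sup]
  | imp φ ψ ih ih' => rw [eval, eval, ih, ih', f.map_himp]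
  | mneg φ ih => rw [eval, eval, ih, f.map_mneg]
  | star φ ψ ih ih' => rw [eval, eval, ih, ih', f.map_mul]
  | wand φ ψ ih ih' => rw [eval, eval, ih, ih', f.map_wand]

/-- The Hilbert systems are sound for the interpretation in algebras. -/
theorem Proves.eval_le {b : Prop} {A : Type v} [DMBIAlgebra A] (hA : b → IsCBIAlgebra A)
    (V : P → A) {φ ψ : Form P} (h : Proves b φ ψ) : eval V φ ≤ eval V ψ := by
  induction h with
  | dne φ hb =>
    have := hA hb
    change (eval V φ ⇨ ⊥) ⇨ ⊥ ≤ eval V φ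
    -- The double complement is met with `⊤ = a ⊔ aᶜ` and distributed; the second summand vanishes.
    rw [himp_bot, himp_bot, ← inf_top_eq ((eval V φ)ᶜᶜ), ← IsCBIAlgebra.sup_compl (eval V φ),
      inf_sup_left, compl_inf_self, sup_bot_eq]
    exact inf_le_right
  | refl φ => exact le_rfl
  | top_intro φ => exact le_top
  | bot_elim φ => exact bot_le
  | and_intro _ _ ih ih' => exact le_inf ih ih'
  | and_left _ ih => exact ih.trans inf_le_left
  | and_right _ ih => exact ih.trans inf_le_right
  | weaken _ ih => exact inf_le_right.trans ih
  | or_elim _ _ ih ih' => exact sup_le ih ih'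
  | or_left _ ih => exact ih.trans le_sup_left
  | or_right _ ih => exact ih.trans le_sup_right
  | imp_elim _ _ ih ih' => exact (le_inf ih ih').trans himp_inf_le
  | imp_intro _ ih => exact le_himp_iff.2 ih
  | star_mono _ _ ih ih' => exact BIAlgebra.mul_le_mul_of_le ih ih'
  | wand_intro _ ih => exact (BIAlgebra.mul_le_iff _ _ _).1 ih
  | wand_elim _ _ ih ih' =>
    exact (BIAlgebra.mul_le_mul_of_le ih ih').trans (BIAlgebra.wand_mul_le _ _)
  | wand_intro' _ ih => exact (BIAlgebra.mul_le_iff _ _ _).1 ((mul_comm _ _).le.trans ih)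
  | wand_elim' _ _ ih ih' =>
    exact (BIAlgebra.mul_le_mul_of_le ih' ih).trans
      ((mul_comm _ _).le.trans (BIAlgebra.wand_mul_le _ _))
  | star_assoc φ ψ ξ => exact (mul_assoc _ _ _).le
  | star_comm φ ψ => exact (mul_comm _ _).le
  | star_mtop φ => exact (mul_one _).le
  | star_mtop' φ => exact (mul_one _).ge
  | mneg_mneg φ => exact (_root_.mneg_mneg _).le
  | mneg_mneg' φ => exact (_root_.mneg_mneg _).ge
  | mneg_wand φ =>
    -- The formula for multiplicative falsum evaluates to `~1`, which the algebra identifies with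
    -- its constant.
    change BIAlgebra.wand _ _ ≤ BIAlgebra.wand _ (_root_.mneg 1)
    rw [mneg_one]
  | mneg_wand' φ =>
    change BIAlgebra.wand _ (_root_.mneg 1) ≤ BIAlgebra.wand _ _
    rw [mneg_one]

theorem _root_.Com.subset_of_le {X : Type v} [Preorder X] [FrameOps X] [IsDMBIFrame X]
    {C D : Com X} (h : C ≤ D) : C.1 ⊆ D.1 := h

/-- Satisfaction in a frame is evaluation in its complex algebra. -/
theorem sat_iff_mem_eval {X : Type v} [Preorder X] [FrameOps X] [IsDMBIFrame X]
    (V : P → Com X) (φ : Form P) :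
    ∀ x : X, Sat (fun p => (V p).1) φ x ↔ x ∈ (eval V φ).1 := by
  induction φ with
  | atom p => exact fun x => Iff.rfl
  | top => exact fun x => (iff_of_true trivial (Set.mem_univ x))
  | bot => exact fun x => Iff.rfl
  | mtop => exact fun x => Iff.rfl
  | and φ ψ ih ih' => exact fun x => and_congr (ih x) (ih' x)
  | or φ ψ ih ih' => exact fun x => or_congr (ih x) (ih' x)
  | imp φ ψ ih ih' =>
    exact fun x => forall_congr' fun y => imp_congr Iff.rfl (imp_congr (ih y) (ih' y))
  | mneg φ ih =>
    intro x
    change _ ↔ x ∈ Complex.wand (eval V φ).1 (Complex.falsum X)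
    rw [Complex.wand_falsum (eval V φ).2]
    exact not_congr (ih _)
  | star φ ψ ih ih' =>
    exact fun x => exists_congr fun w => exists_congr fun y => exists_congr fun z =>
      and_congr Iff.rfl (and_congr Iff.rfl (and_congr (ih y) (ih' z)))
  | wand φ ψ ih ih' =>
    exact fun x => forall_congr' fun w => forall_congr' fun y => forall_congr' fun z =>
      imp_congr Iff.rfl (imp_congr Iff.rfl (imp_congr (ih y) (ih' z)))

/-! ### Derived rules of the Hilbert systems. -/

namespace Proves

variable {b : Prop} {φ ψ χ φ' ψ' : Form P}

/-- Cut is not a primitive rule: the second derivation is weakened, turned into an implication, and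
detached. -/
theorem trans (h : Proves b φ ψ) (h' : Proves b ψ χ) : Proves b φ χ :=
  imp_elim (imp_intro (weaken h')) h

theorem and_elim_left (φ ψ : Form P) : Proves b (and φ ψ) φ := and_left (refl _)

theorem and_elim_right (φ ψ : Form P) : Proves b (and φ ψ) ψ := and_right (refl _)

theorem imp_mono (h : Proves b φ' φ) (h' : Proves b ψ ψ') :
    Proves b (imp φ ψ) (imp φ' ψ') :=
  imp_intro ((imp_elim (and_elim_left _ _) ((and_elim_right _ _).trans h)).trans h')

theorem wand_mono (h : Proves b φ' φ) (h' : Proves b ψ ψ') :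
    Proves b (wand φ ψ) (wand φ' ψ') :=
  wand_intro ((wand_elim (refl _) h).trans h')

/-- The given direction of associativity, applied twice between commutations, rotates the factors
into place. -/
theorem star_assoc' (φ ψ χ : Form P) : Proves b (star φ (star ψ χ)) (star (star φ ψ) χ) :=
  (star_comm _ _).trans ((star_assoc _ _ _).trans ((star_comm _ _).trans
    ((star_assoc _ _ _).trans (star_comm _ _))))

end Proves

/-! ### The Lindenbaum algebra. -/

/-- Interderivability of formulas. -/
def setoid (b : Prop) (P : Type u) : Setoid (Form P) where
  r φ ψ := Proves b φ ψ ∧ Proves b ψ φ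
  iseqv := ⟨fun φ => ⟨.refl φ, .refl φ⟩, fun h => ⟨h.2, h.1⟩,
    fun h h' => ⟨h.1.trans h'.1, h'.2.trans h.2⟩⟩

/-- The Lindenbaum algebra: formulas up to interderivability. -/
def Lindenbaum (b : Prop) (P : Type u) : Type u := Quotient (setoid b P)

namespace Lindenbaum

variable {b : Prop}

/-- The class of a formula. -/
def mk (b : Prop) (φ : Form P) : Lindenbaum b P := Quotient.mk (setoid b P) φ

theorem ind {p : Lindenbaum b P → Prop} (h : ∀ φ, p (mk b φ)) (a : Lindenbaum b P) : p a :=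
  Quotient.ind h a

theorem mk_eq {φ ψ : Form P} (h : Proves b φ ψ) (h' : Proves b ψ φ) : mk b φ = mk b ψ :=
  Quotient.sound (s := setoid b P) ⟨h, h'⟩

instance : PartialOrder (Lindenbaum b P) where
  le := Quotient.lift₂ (Proves b) fun _ _ _ _ h h' =>
    propext ⟨fun k => h.2.trans (k.trans h'.1), fun k => h.1.trans (k.trans h'.2)⟩
  le_refl := ind fun φ => Proves.refl φ
  le_trans := ind fun _ => ind fun _ => ind fun _ h h' => Proves.trans h h'
  le_antisymm := ind fun _ => ind fun _ h h' => mk_eq h h'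

theorem mk_le_mk {φ ψ : Form P} : mk b φ ≤ mk b ψ ↔ Proves b φ ψ := Iff.rfl

/-- A binary connective as an operation on the Lindenbaum algebra. -/
def map₂ (f : Form P → Form P → Form P)
    -- Both directions of derivability are made available because implications are antitone in their
    -- first argument.
    (hf : ∀ φ φ' ψ ψ', Proves b φ φ' → Proves b φ' φ → Proves b ψ ψ' → Proves b ψ' ψ →
      Proves b (f φ ψ) (f φ' ψ')) :
    Lindenbaum b P → Lindenbaum b P → Lindenbaum b P :=
  Quotient.map₂ f fun _ _ h _ _ h' =>
    ⟨hf _ _ _ _ h.1 h.2 h'.1 h'.2, hf _ _ _ _ h.2 h.1 h'.2 h'.1⟩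

instance : DMBIAlgebra (Lindenbaum b P) where
  inf := map₂ and fun _ _ _ _ h _ h' _ =>
    .and_intro ((Proves.and_elim_left _ _).trans h) ((Proves.and_elim_right _ _).trans h')
  inf_le_left := ind fun _ => ind fun _ => Proves.and_elim_left _ _
  inf_le_right := ind fun _ => ind fun _ => Proves.and_elim_right _ _
  le_inf := ind fun _ => ind fun _ => ind fun _ h h' => Proves.and_intro h h'
  sup := map₂ or fun _ _ _ _ h _ h' _ => .or_elim (.or_left h) (.or_right h')
  le_sup_left := ind fun _ => ind fun _ => Proves.or_left (.refl _)
  le_sup_right := ind fun _ => ind fun _ => Proves.or_right (.refl _)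
  sup_le := ind fun _ => ind fun _ => ind fun _ h h' => Proves.or_elim h h'
  top := mk b Form.top
  le_top := ind fun _ => Proves.top_intro _
  bot := mk b Form.bot
  bot_le := ind fun _ => Proves.bot_elim _
  himp := map₂ imp fun _ _ _ _ _ h h' _ => .imp_mono h h'
  le_himp_iff := ind fun _ => ind fun _ => ind fun _ =>
    ⟨fun h => Proves.imp_elim ((Proves.and_elim_left _ _).trans h) (.and_elim_right _ _),
      fun h => Proves.imp_intro h⟩
  compl a := map₂ imp (fun _ _ _ _ _ h h' _ => .imp_mono h h') a (mk b Form.bot)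
  himp_bot _ := rfl
  mul := map₂ star fun _ _ _ _ h _ h' _ => .star_mono h h'
  mul_assoc := ind fun _ => ind fun _ => ind fun _ =>
    mk_eq (.star_assoc _ _ _) (.star_assoc' _ _ _)
  mul_comm := ind fun _ => ind fun _ => mk_eq (.star_comm _ _) (.star_comm _ _)
  one := mk b mtop
  mul_one := ind fun _ => mk_eq (.star_mtop _) (.star_mtop' _)
  one_mul := ind fun _ => mk_eq ((Proves.star_comm _ _).trans (.star_mtop _))
    ((Proves.star_mtop' _).trans (.star_comm _ _))
  wand := map₂ Form.wand fun _ _ _ _ _ h h' _ => .wand_mono h h'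
  mul_le_iff := ind fun _ => ind fun _ => ind fun _ =>
    ⟨fun h => Proves.wand_intro h, fun h => Proves.wand_elim h (.refl _)⟩
  mbot := mk b Form.mbot
  -- Wands into multiplicative falsum are interderivable with `~`, which reduces the equation to the
  -- double negation rules.
  wand_wand_mbot := ind fun φ => mk_eq
    ((Proves.wand_mono (.mneg_wand φ) (.refl _)).trans
      ((Proves.mneg_wand' _).trans (.mneg_mneg φ)))
    ((Proves.mneg_mneg' φ).trans ((Proves.mneg_wand _).trans
      (.wand_mono (.mneg_wand' φ) (.refl _))))
  wand_one_mbot := mk_eq (.mneg_wand' _) (.mneg_wand _)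

/-- The double complement of `a ⊔ aᶜ` is `⊤` in any Heyting algebra, so `dne` yields excluded
middle. -/
theorem isCBIAlgebra (hb : b) : IsCBIAlgebra (Lindenbaum b P) where
  sup_compl a := by
    have h : ∀ c : Lindenbaum b P, cᶜᶜ ≤ c := ind fun φ => Proves.dne φ hb
    refine top_le_iff.1 (le_trans ?_ (h _))
    rw [compl_sup, inf_compl_self, compl_bot]

/-- Only `~` is not immediate: the algebra reads it as a wand into multiplicative falsum, an
interderivable but different formula. -/
theorem eval_mk (φ : Form P) : eval (fun p => mk b (atom p)) φ = mk b φ := by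
  induction φ with
  | atom p => rfl
  | top => rfl
  | bot => rfl
  | mtop => rfl
  | and φ ψ ih ih' => rw [eval, ih, ih']; rfl
  | or φ ψ ih ih' => rw [eval, ih, ih']; rfl
  | imp φ ψ ih ih' => rw [eval, ih, ih']; rfl
  | mneg φ ih => rw [eval, ih]; exact mk_eq (.mneg_wand' φ) (.mneg_wand φ)
  | star φ ψ ih ih' => rw [eval, ih, ih']; rfl
  | wand φ ψ ih ih' => rw [eval, ih, ih']; rfl

/-- The truth lemma for the prime filter frame of the Lindenbaum algebra. -/
theorem sat_iff (φ : Form P) (F : PrimeFilter (Lindenbaum b P)) :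
    Sat (fun p => {G : PrimeFilter (Lindenbaum b P) | mk b (atom p) ∈ G.carrier}) φ F ↔
      mk b φ ∈ F.carrier := by
  refine (sat_iff_mem_eval (fun p => (thetaHom _).toFun (mk b (atom p))) φ F).trans ?_
  rw [eval_map, eval_mk]
  rfl

/-- An underivable sequent is a failure of `≤` between two classes, which some prime filter
witnesses; hence one frame with one valuation refutes all underivable sequents. -/
theorem proves_of_forall_sat {φ ψ : Form P}
    (h : ∀ F : PrimeFilter (Lindenbaum b P),
      Sat (fun p => {G : PrimeFilter (Lindenbaum b P) | mk b (atom p) ∈ G.carrier}) φ F →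
      Sat (fun p => {G : PrimeFilter (Lindenbaum b P) | mk b (atom p) ∈ G.carrier}) ψ F) :
    Proves b φ ψ := by
  by_contra hn
  obtain ⟨F, h1, h2⟩ := PrimeFilter.exists_of_not_le (mt mk_le_mk.1 hn)
  exact h2 ((sat_iff ψ F).1 (h F ((sat_iff φ F).2 h1)))

end Lindenbaum

/-- Restricting entailment to frames in the universe of `P` loses nothing, since the prime filter
frame of the Lindenbaum algebra lives there. -/
theorem proves_false_iff (φ ψ : Form P) : Proves False φ ψ ↔ DMBIEntails φ ψ := by
  constructor
  · intro h X _ _ _ V hV x hx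
    rw [sat_iff_mem_eval (fun p => ⟨V p, hV p⟩)] at hx ⊢
    exact Com.subset_of_le (h.eval_le False.elim _) hx
  · intro h
    exact Lindenbaum.proves_of_forall_sat
      (h _ _ fun p => PrimeFilter.isUpperSet_setOf_mem _)

theorem proves_true_iff (φ ψ : Form P) : Proves True φ ψ ↔ CBIEntails φ ψ := by
  constructor
  · intro h X _ _ _ V x hx
    rw [sat_iff_mem_eval
      (fun p => ⟨V p, Complex.isUpperSet_of_discrete IsCBIFrame.eq_of_le _⟩)] at hx ⊢
    exact Com.subset_of_le (h.eval_le (fun _ => inferInstance) _) hx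
  · intro h
    -- This makes the prime filter frame of the Lindenbaum algebra a CBI frame, so that entailment
    -- applies to it.
    have := Lindenbaum.isCBIAlgebra (P := P) trivial
    exact Lindenbaum.proves_of_forall_sat (h _ _)

end Form

/-! ## Duality -/

/-- A bijective homomorphism of DMBI algebras is an isomorphism. -/
noncomputable def DMBIAlg.isoOfBijective {A B : DMBIAlg.{u}} (f : DMBIHom A.carrier B.carrier)
    (hf : Function.Bijective f.toFun) : A ≅ B where
  hom := f
  inv := f.inverse hf
  hom_inv_id := f.comp_inverse hf
  inv_hom_id := f.inverse_comp hf

/-- A bijective homomorphism of CBI algebras is an isomorphism. -/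
noncomputable def CBIAlg.isoOfBijective {A B : CBIAlg.{u}} (f : DMBIHom A.carrier B.carrier)
    (hf : Function.Bijective f.toFun) : A ≅ B where
  hom := f
  inv := f.inverse hf
  hom_inv_id := f.comp_inverse hf
  inv_hom_id := f.inverse_comp hf

/-- A homeomorphism that is a DMBI morphism in both directions is an isomorphism of DMBI spaces. -/
def DMBISp.isoOfHomeomorph {X Y : DMBISp.{u}} (g : X.carrier ≃ₜ Y.carrier)
    (hg : IsDMBIMorphism g) (hg' : IsDMBIMorphism g.symm) : X ≅ Y where
  hom := ⟨g, g.continuous, hg⟩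
  inv := ⟨g.symm, g.symm.continuous, hg'⟩
  hom_inv_id := DMBISp.Hom.ext (funext g.symm_apply_apply)
  inv_hom_id := DMBISp.Hom.ext (funext g.apply_symm_apply)

/-- A homeomorphism that is a DMBI morphism in both directions is an isomorphism of CBI spaces. -/
def CBISp.isoOfHomeomorph {X Y : CBISp.{u}} (g : X.carrier ≃ₜ Y.carrier)
    (hg : IsDMBIMorphism g) (hg' : IsDMBIMorphism g.symm) : X ≅ Y where
  hom := ⟨g, g.continuous, (isCBIMorphism_iff X.eq_of_le Y.eq_of_le _).2 hg⟩
  inv := ⟨g.symm, g.symm.continuous, (isCBIMorphism_iff Y.eq_of_le X.eq_of_le _).2 hg'⟩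
  hom_inv_id := CBISp.Hom.ext (funext g.symm_apply_apply)
  inv_hom_id := CBISp.Hom.ext (funext g.apply_symm_apply)

theorem PrimeFilter.continuous_isDMBIMorphism_comap {A : Type u} {B : Type v} [DMBIAlgebra A]
    [DMBIAlgebra B] (f : DMBIHom A B) : Continuous (comap f) ∧ IsDMBIMorphism (comap f) :=
  ⟨continuous_comap f, isDMBIMorphism_comap f⟩

theorem PrimeFilter.continuous_isCBIMorphism_comap {A : Type u} {B : Type v} [DMBIAlgebra A]
    [IsCBIAlgebra A] [DMBIAlgebra B] [IsCBIAlgebra B] (f : DMBIHom A B) :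
    Continuous (comap f) ∧ IsCBIMorphism (comap f) :=
  ⟨continuous_comap f, (isCBIMorphism_iff eq_of_le eq_of_le _).2 (isDMBIMorphism_comap f)⟩

/-- The prime filter functor on DMBI algebras. -/
abbrev primeFilterDMBI : DMBIAlg.{u}ᵒᵖ ⥤ DMBISp.{u} :=
  prDMBI (fun _ => inferInstance) (fun _ _ f => PrimeFilter.continuous_isDMBIMorphism_comap f)

/-- The prime filter functor on CBI algebras. -/
abbrev primeFilterCBI : CBIAlg.{u}ᵒᵖ ⥤ CBISp.{u} :=
  prCBI (fun _ => inferInstance) (fun _ => PrimeFilter.eq_of_le)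
    (fun _ _ f => PrimeFilter.continuous_isCBIMorphism_comap f)

/-- The representation map as a natural isomorphism, for DMBI algebras. -/
noncomputable def thetaDMBI : 𝟭 DMBIAlg.{u} ≅ primeFilterDMBI.rightOp ⋙ clopDMBI :=
  NatIso.ofComponents
    (fun A => DMBIAlg.isoOfBijective (B := (primeFilterDMBI.rightOp ⋙ clopDMBI).obj A)
      (thetaClop A.carrier) (thetaClop_bijective A.carrier))
    -- Both paths of the naturality square send `a` to the set of prime filters containing `f a`.
    (fun _ => rfl)

/-- The representation map as a natural isomorphism, for CBI algebras. -/
noncomputable def thetaCBI : 𝟭 CBIAlg.{u} ≅ primeFilterCBI.rightOp ⋙ clopCBI :=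
  NatIso.ofComponents
    (fun A => CBIAlg.isoOfBijective (B := (primeFilterCBI.rightOp ⋙ clopCBI).obj A)
      (thetaClop A.carrier) (thetaClop_bijective A.carrier))
    (fun _ => rfl)

/-- The map `eta` as a natural isomorphism, for DMBI spaces. -/
noncomputable def etaDMBI : 𝟭 DMBISp.{u} ≅ clopDMBI.rightOp ⋙ primeFilterDMBI :=
  NatIso.ofComponents
    (fun X => DMBISp.isoOfHomeomorph (Y := (clopDMBI.rightOp ⋙ primeFilterDMBI).obj X)
      (etaHomeomorph X.carrier) (isDMBIMorphism_eta X.carrier)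
      (isDMBIMorphism_etaHomeomorph_symm X.carrier))
    (fun _ => rfl)

/-- The map `eta` as a natural isomorphism, for CBI spaces. -/
noncomputable def etaCBI : 𝟭 CBISp.{u} ≅ clopCBI.rightOp ⋙ primeFilterCBI :=
  NatIso.ofComponents
    (fun X => CBISp.isoOfHomeomorph (Y := (clopCBI.rightOp ⋙ primeFilterCBI).obj X)
      (etaHomeomorph X.carrier) (isDMBIMorphism_eta X.carrier)
      (isDMBIMorphism_etaHomeomorph_symm X.carrier))
    (fun _ => rfl)

end primeFilterFrame

/-! ### The main theorem. -/

theorem mainTheorem9 :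
    -- The prime filter frame of a DMBI algebra is a DMBI frame and `theta` is an embedding.
    (∀ (A : Type u) [DMBIAlgebra A], ∃ _ : IsDMBIFrame (PrimeFilter A),
      ∃ φ : DMBIHom A (Com (PrimeFilter A)), φ.toFun = theta A ∧ Function.Injective φ.toFun ∧
        IsDMBISubalgebra (Set.range φ.toFun)) ∧
    -- The prime filter frame of a CBI algebra is a CBI frame and `theta` is an embedding.
    (∀ (A : Type u) [DMBIAlgebra A] [IsCBIAlgebra A], ∃ _ : IsCBIFrame (PrimeFilter A),
      IsCBIAlgebra (Com (PrimeFilter A)) ∧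
      ∃ φ : DMBIHom A (Com (PrimeFilter A)), φ.toFun = theta A ∧ Function.Injective φ.toFun ∧
        IsDMBISubalgebra (Set.range φ.toFun)) ∧
    -- Soundness and completeness of the relational semantics of DMBI and of CBI.
    (∀ (P : Type u) (φ ψ : Form P), Form.Proves False φ ψ ↔ Form.DMBIEntails φ ψ) ∧
    (∀ (P : Type u) (φ ψ : Form P), Form.Proves True φ ψ ↔ Form.CBIEntails φ ψ) ∧
    -- Duality between DMBI algebras and DMBI spaces.
    (∃ (hobj : ∀ A : DMBIAlg.{u}, IsDMBISpace (PrimeFilter A.carrier))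
      (hmap : ∀ (A B : DMBIAlg.{u}) (f : A ⟶ B),
        Continuous (PrimeFilter.comap f) ∧ IsDMBIMorphism (PrimeFilter.comap f))
      (θ : 𝟭 DMBIAlg.{u} ≅ (prDMBI hobj hmap).rightOp ⋙ clopDMBI)
      (η : 𝟭 DMBISp.{u} ≅ clopDMBI.rightOp ⋙ prDMBI hobj hmap),
      (∀ (A : DMBIAlg.{u}) (a : A.carrier),
        (((θ.hom.app A).toFun a : Clop (PrimeFilter A.carrier))).1 = {F | a ∈ F.carrier}) ∧
      (∀ (X : DMBISp.{u}) (x : X.carrier),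
        ((η.hom.app X).toFun x : PrimeFilter (Clop X.carrier)).carrier = {C | x ∈ C.1}) ∧
      (∀ A : DMBIAlg.{u}, η.hom.app ((prDMBI hobj hmap).obj (op A)) ≫
        (prDMBI hobj hmap).map (θ.hom.app A).op = 𝟙 _) ∧
      (∀ X : DMBISp.{u}, θ.hom.app (clopDMBI.obj (op X)) ≫
        clopDMBI.map (η.hom.app X).op = 𝟙 _)) ∧
    -- Duality between CBI algebras and CBI spaces.
    (∃ (hobj : ∀ A : CBIAlg.{u}, IsDMBISpace (PrimeFilter A.carrier))
      (heq : ∀ (A : CBIAlg.{u}) (F G : PrimeFilter A.carrier), F ≤ G → F = G)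
      (hmap : ∀ (A B : CBIAlg.{u}) (f : A ⟶ B),
        Continuous (PrimeFilter.comap f) ∧ IsCBIMorphism (PrimeFilter.comap f))
      (θ : 𝟭 CBIAlg.{u} ≅ (prCBI hobj heq hmap).rightOp ⋙ clopCBI)
      (η : 𝟭 CBISp.{u} ≅ clopCBI.rightOp ⋙ prCBI hobj heq hmap),
      (∀ (A : CBIAlg.{u}) (a : A.carrier),
        (((θ.hom.app A).toFun a : Clop (PrimeFilter A.carrier))).1 = {F | a ∈ F.carrier}) ∧
      (∀ (X : CBISp.{u}) (x : X.carrier),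
        ((η.hom.app X).toFun x : PrimeFilter (Clop X.carrier)).carrier = {C | x ∈ C.1}) ∧
      (∀ A : CBIAlg.{u}, η.hom.app ((prCBI hobj heq hmap).obj (op A)) ≫
        (prCBI hobj heq hmap).map (θ.hom.app A).op = 𝟙 _) ∧
      (∀ X : CBISp.{u}, θ.hom.app (clopCBI.obj (op X)) ≫
        clopCBI.map (η.hom.app X).op = 𝟙 _)) := by
  refine ⟨fun A _ => ?_, fun A _ _ => ?_, fun P => Form.proves_false_iff,
    fun P => Form.proves_true_iff, ?_, ?_⟩
  · exact ⟨PrimeFilter.instIsDMBIFrame, exists_theta_embedding A⟩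
  · have : IsCBIFrame (PrimeFilter A) := PrimeFilter.instIsCBIFrame
    exact ⟨this, Com.instIsCBIAlgebra _, exists_theta_embedding A⟩
  -- The triangle identities are definitional: `a` lies in the inverse image of `eta F` under
  -- `theta` exactly when `F ∈ {G | a ∈ G}`, that is `a ∈ F`; the identity on spaces unfolds in the
  -- same way.
  · exact ⟨_, _, thetaDMBI, etaDMBI, fun _ _ => rfl, fun _ _ => rfl, fun _ => rfl, fun _ => rfl⟩
  · exact ⟨_, _, _, thetaCBI, etaCBI, fun _ _ => rfl, fun _ _ => rfl, fun _ => rfl, fun _ => rfl⟩
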